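/- Let $K$ be a commutative ring with unity, $n=2\nu+1\ge 1$ an odd integer, $M_0$ a finitely generated projective $K$-module of constant rank $n$, and $q_0\colon M_0\to K$ a quadratic form with polar form $b_{q_0}(u,v)=q_0(u+v)-q_0(u)-q_0(v)$. Let $\Xi$ be the symmetric $n\times n$ matrix over $\mathbb Z[\xi_i,\xi_{ij}]$ (with $\xi_{ij}=\xi_{ji}$) having diagonal entries $2\xi_i$ and off-diagonal entries $\xi_{ij}$; its determinant is divisible by $2$, and we put $P_n=\tfrac12\det\Xi$. Assume that $q_0$ is semiregular, i.e. that the elements $P_n(q_0(u_i),b_{q_0}(u_i,u_j))$, for $u_1,\dots,u_n\in M_0$, generate the unit ideal of $K$. Let $M=e_{-2}K\oplus e_{-1}K\oplus M_0\oplus e_1K\oplus e_2K$ with the quadratic form $q(x_{-2},x_{-1},u,x_1,x_2)=q_0(u)+x_{-1}x_1+x_{-2}x_2$, and let $\mathrm O(M,q)$ be the group of $K$-linear automorphisms of $M$ preserving $q$. For $i,j\in\{\pm1,\pm2\}$ with $i\ne\pm j$, $y\in K$ and $u\in M_0$ let $$T_{ij}(y)=1+e_{ij}y-e_{-j,-i}y,\qquad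 T_i(u)=1+e_{0,i}u-e_{-i,0}u^*-e_{-i,i}q_0(u),\qquad u^*=b_{q_0}(u,-),$$ in block matrix notation with respect to this decomposition (index $0$ corresponding to $M_0$); these are elements of $\mathrm O(M,q)$. Let $\mathrm{EO}(M,q)\le\mathrm O(M,q)$ be the subgroup generated by all $T_{ij}(y)$ and $T_i(u)$. Let $(N_0,I)$ be an admissible pair, i.e. $I\trianglelefteq K$ is an ideal and $N_0\le M_0$ is a submodule such that $M_0I\le N_0$ and $b_{q_0}(M_0,N_0)+q_0(N_0)\subseteq I$. Put $N=e_{-2}I\oplus e_{-1}I\oplus N_0\oplus e_1I\oplus e_2I$. Let $\mathrm O(M,q,N_0,I)$ be the group of all $\phi\in\mathrm O(M,q)$ with $\phi(v)\equiv v\pmod N$ for all $v\in M$, and let $\mathrm{EO}(M,q,N_0,I)$ be the subgroup of $\mathrm O(M,q)$ generated by all $\mathrm{EO}(M,q)$-conjugates of the elements $T_{ij}(y)$, $T_i(u)$ with $i,j\in\{\pm1,\pm2\}$, $i\ne\pm j$, $y\in I$, $u\in N_0$. Then: 1. $\mathrm{EO}(M,q,N_0,I)$ is a normal subgroup of $\mathrm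 O(M,q)$; 2. $[\mathrm{EO}(M,q),\mathrm O(M,q,N_0,I)]\le\mathrm{EO}(M,q,N_0,I)$. -/

import Mathlib

namespace OddOrth

/-! ## The semidiscriminant polynomial and semiregular forms -/

/-- The symmetric `n × n` matrix `Ξ` over `ℤ[ξ]` with diagonal entries `2 ξ_i` and off-diagonal
entries `ξ_{ij} = ξ_{ji}`.  The variables are indexed by unordered pairs: `ξ_i` is the variable
of `s(i, i)`, and `ξ_{ij}` that of `s(i, j)`. -/
noncomputable def genericMatrix (n : ℕ) :
    Matrix (Fin n) (Fin n) (MvPolynomial (Sym2 (Fin n)) ℤ) :=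
  fun i j => if i = j then 2 * MvPolynomial.X s(i, i) else MvPolynomial.X s(i, j)

/-- In characteristic two, a symmetric matrix of odd size with zero diagonal is singular. -/
theorem det_eq_zero_of_charTwo {R : Type*} [CommRing R] (h2 : (2 : R) = 0) (ν : ℕ)
    (A : Matrix (Fin (2 * ν + 1)) (Fin (2 * ν + 1)) R)
    (hs : ∀ i j, A i j = A j i) (hd : ∀ i, A i i = 0) : A.det = 0 := by
  rw [Matrix.det_apply']
  refine Finset.sum_involution (fun σ _ => σ⁻¹) ?_ ?_ (fun _ _ => Finset.mem_univ _)
    (fun σ _ => inv_inv σ)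
  · intro σ _
    have h : ∏ i, A (σ⁻¹ i) i = ∏ i, A (σ i) i := by
      rw [← Equiv.prod_comp σ (fun i => A (σ⁻¹ i) i)]
      refine Finset.prod_congr rfl fun i _ => ?_
      rw [Equiv.Perm.inv_def, Equiv.symm_apply_apply, hs]
    rw [h, Equiv.Perm.sign_inv, ← two_mul, h2, zero_mul]
  · intro σ _ hne hσ
    apply hne
    obtain ⟨i, hi⟩ : ∃ i, σ i = i := by
      have hodd : ¬ 2 ∣ Fintype.card (Fin (2 * ν + 1)) := by
        rw [Fintype.card_fin]; omega
      have h1 : σ ^ 2 ^ 1 = 1 := by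
        rw [pow_one, pow_two]
        nth_rewrite 1 [← hσ]
        exact inv_mul_cancel σ
      have : Fact (Nat.Prime 2) := ⟨Nat.prime_two⟩
      exact Equiv.Perm.exists_fixed_point_of_prime hodd h1
    rw [Finset.prod_eq_zero (Finset.mem_univ i) (by rw [hi, hd]), mul_zero]

theorem two_dvd_det (ν : ℕ) : 2 ∣ (genericMatrix (2 * ν + 1)).det := by
  rw [← Ideal.mem_span_singleton, ← Ideal.Quotient.eq_zero_iff_mem, RingHom.map_det]
  have h2 : (2 : MvPolynomial (Sym2 (Fin (2 * ν + 1))) ℤ ⧸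
      Ideal.span {(2 : MvPolynomial (Sym2 (Fin (2 * ν + 1))) ℤ)}) = 0 := by
    have := Ideal.Quotient.eq_zero_iff_mem.mpr (Ideal.mem_span_singleton_self
      (2 : MvPolynomial (Sym2 (Fin (2 * ν + 1))) ℤ))
    rwa [map_ofNat] at this
  refine det_eq_zero_of_charTwo h2 ν _ (fun i j => ?_) (fun i => ?_)
  · by_cases h : i = j
    · rw [h]
    · simp [genericMatrix, h, Ne.symm h, Sym2.eq_swap]
  · simp [genericMatrix]

/-- `P_n = (1/2) det Ξ ∈ ℤ[ξ]` for `n = 2 ν + 1`. -/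
noncomputable def semidisc (ν : ℕ) : MvPolynomial (Sym2 (Fin (2 * ν + 1))) ℤ :=
  (two_dvd_det ν).choose

theorem two_mul_semidisc (ν : ℕ) : 2 * semidisc ν = (genericMatrix (2 * ν + 1)).det :=
  (two_dvd_det ν).choose_spec.symm

section

variable {K : Type*} [CommRing K] {M₀ : Type*} [AddCommGroup M₀] [Module K M₀]

/-- The values `ξ_i = q₀(u_i)`, `ξ_{ij} = b_{q₀}(u_i, u_j)`. -/
def gramValue (q₀ : QuadraticForm K M₀) {n : ℕ} (u : Fin n → M₀) : Sym2 (Fin n) → K :=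
  Sym2.lift ⟨fun i j => if i = j then q₀ (u i) else QuadraticMap.polar q₀ (u i) (u j),
    fun i j => by
      by_cases h : i = j
      · rw [h]
      · simp [h, Ne.symm h, QuadraticMap.polar_comm q₀ (u i) (u j)]⟩

/-- The form `q₀` on a module of rank `n = 2 ν + 1` is semiregular: the values
`P_n(q₀(u_i), b_{q₀}(u_i, u_j))`, `u_1, …, u_n ∈ M₀`, generate the unit ideal. -/
def Semiregular (ν : ℕ) (q₀ : QuadraticForm K M₀) : Prop :=
  Ideal.span {x : K | ∃ u : Fin (2 * ν + 1) → M₀,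
    x = MvPolynomial.aeval (gramValue q₀ u) (semidisc ν)} = ⊤

end

/-! ## The quadratic module `M = e₋₂K ⊕ e₋₁K ⊕ M₀ ⊕ e₁K ⊕ e₂K` -/

/-- The index set `{-2, -1, 1, 2}`. -/
inductive Idx : Type
  | neg2 | neg1 | pos1 | pos2
  deriving DecidableEq

instance : Neg Idx :=
  ⟨fun i => match i with
    | .neg2 => .pos2
    | .neg1 => .pos1
    | .pos1 => .neg1
    | .pos2 => .neg2⟩

theorem Idx.neg_neg2 : -Idx.neg2 = .pos2 := rfl

theorem Idx.neg_neg1 : -Idx.neg1 = .pos1 := rfl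

theorem Idx.neg_pos1 : -Idx.pos1 = .neg1 := rfl

theorem Idx.neg_pos2 : -Idx.pos2 = .neg2 := rfl

variable {K : Type*} [CommRing K] {M₀ : Type*} [AddCommGroup M₀] [Module K M₀]

/-- The module `M`; `(x, u)` stands for `e₋₂x₋₂ + e₋₁x₋₁ + u + e₁x₁ + e₂x₂`. -/
abbrev Mod (K M₀ : Type*) : Type _ := (Idx → K) × M₀

/-- `q(x₋₂, x₋₁, u, x₁, x₂) = q₀(u) + x₋₁x₁ + x₋₂x₂`. -/
noncomputable def form (q₀ : QuadraticForm K M₀) : QuadraticForm K (Mod K M₀) :=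
  q₀.comp (LinearMap.snd K (Idx → K) M₀) +
    QuadraticMap.linMulLin (LinearMap.proj .neg1 ∘ₗ LinearMap.fst K (Idx → K) M₀)
      (LinearMap.proj .pos1 ∘ₗ LinearMap.fst K (Idx → K) M₀) +
    QuadraticMap.linMulLin (LinearMap.proj .neg2 ∘ₗ LinearMap.fst K (Idx → K) M₀)
      (LinearMap.proj .pos2 ∘ₗ LinearMap.fst K (Idx → K) M₀)

theorem form_apply (q₀ : QuadraticForm K M₀) (v : Mod K M₀) :
    form q₀ v = q₀ v.2 + v.1 .neg1 * v.1 .pos1 + v.1 .neg2 * v.1 .pos2 := rfl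

/-- The orthogonal group `O(M, q)`. -/
def orth (q₀ : QuadraticForm K M₀) : Subgroup (Mod K M₀ ≃ₗ[K] Mod K M₀) where
  carrier := {φ | ∀ v, form q₀ (φ v) = form q₀ v}
  one_mem' := fun _ => rfl
  mul_mem' := fun {φ ψ} hφ hψ v => (hφ (ψ v)).trans (hψ v)
  inv_mem' := fun {φ} hφ v => by
    have h : φ (φ⁻¹ v) = v := φ.apply_symm_apply v
    rw [← hφ (φ⁻¹ v), h]

/-! ## Elementary transvections -/

/-- The endomorphism `1 + e_{ij} y - e_{-j,-i} y` of `M`. -/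
def rootMap (M₀ : Type*) [AddCommGroup M₀] [Module K M₀] (i j : Idx) (y : K) :
    Mod K M₀ →ₗ[K] Mod K M₀ where
  toFun v := v + (Pi.single i (y * v.1 j), 0) - (Pi.single (-j) (y * v.1 (-i)), 0)
  map_add' v w := by
    simp only [Prod.fst_add, Pi.add_apply, mul_add, Pi.single_add]
    ext <;> simp <;> ring
  map_smul' a v := by
    ext k <;> simp [Pi.single_apply]
    split_ifs <;> ring

/-- The endomorphism `1 + e_{0,i} u - e_{-i,0} u^* - e_{-i,i} q₀(u)` of `M`,
where `u^* = b_{q₀}(u, -)`. -/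
def shortMap (q₀ : QuadraticForm K M₀) (i : Idx) (u : M₀) : Mod K M₀ →ₗ[K] Mod K M₀ where
  toFun v := v + (0, v.1 i • u) - (Pi.single (-i) (QuadraticMap.polar q₀ u v.2), 0)
    - (Pi.single (-i) (q₀ u * v.1 i), 0)
  map_add' v w := by
    ext k
    · simp [Pi.single_apply, QuadraticMap.polar_add_right]
      split_ifs <;> ring
    · simp [add_smul]
      abel
  map_smul' a v := by
    ext k
    · simp [Pi.single_apply, QuadraticMap.polar_smul_right]
      split_ifs <;> ring
    · simp [mul_smul]

theorem rootMap_comp (i j : Idx) (h₁ : i ≠ j) (h₂ : i ≠ -j) (y z : K) (hyz : y + z = 0) :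
    (rootMap M₀ i j y) ∘ₗ (rootMap M₀ i j z) = LinearMap.id := by
  obtain rfl : z = -y := by linear_combination hyz
  refine LinearMap.ext fun v => Prod.ext (funext fun k => ?_) (by simp [rootMap])
  cases i <;> cases j <;> first
    | exact absurd rfl h₁
    | exact absurd rfl h₂
    | (cases k <;> simp [rootMap, Idx.neg_neg2, Idx.neg_neg1, Idx.neg_pos1, Idx.neg_pos2])

theorem shortMap_comp (q₀ : QuadraticForm K M₀) (i : Idx) (u w : M₀) (huw : u + w = 0) :
    (shortMap q₀ i u) ∘ₗ (shortMap q₀ i w) = LinearMap.id := by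
  obtain rfl : w = -u := (neg_eq_of_add_eq_zero_right huw).symm
  refine LinearMap.ext fun v => Prod.ext (funext fun k => ?_) ?_
  · cases i <;> cases k <;>
      simp [shortMap, Idx.neg_neg2, Idx.neg_neg1, Idx.neg_pos1, Idx.neg_pos2,
        QuadraticMap.polar_add_right, QuadraticMap.polar_neg_left, QuadraticMap.polar_neg_right,
        QuadraticMap.polar_smul_right, QuadraticMap.polar_self] <;> ring
  · cases i <;> simp [shortMap, Idx.neg_neg2, Idx.neg_neg1, Idx.neg_pos1, Idx.neg_pos2]

theorem form_rootMap (q₀ : QuadraticForm K M₀) (i j : Idx) (h₁ : i ≠ j) (h₂ : i ≠ -j) (y : K)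
    (v : Mod K M₀) : form q₀ (rootMap M₀ i j y v) = form q₀ v := by
  cases i <;> cases j <;> first
    | exact absurd rfl h₁
    | exact absurd rfl h₂
    | (simp [rootMap, form_apply, Idx.neg_neg2, Idx.neg_neg1, Idx.neg_pos1, Idx.neg_pos2]
       ring)

theorem form_shortMap (q₀ : QuadraticForm K M₀) (i : Idx) (u : M₀) (v : Mod K M₀) :
    form q₀ (shortMap q₀ i u v) = form q₀ v := by
  have h : ∀ a : K, q₀ (v.2 + a • u) =
      q₀ v.2 + a * a * q₀ u + a * QuadraticMap.polar q₀ u v.2 := fun a => by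
    rw [QuadraticMap.map_add q₀, QuadraticMap.map_smul, QuadraticMap.polar_smul_right,
      QuadraticMap.polar_comm, smul_eq_mul, smul_eq_mul]
  cases i <;>
    (simp [shortMap, form_apply, h, Idx.neg_neg2, Idx.neg_neg1, Idx.neg_pos1, Idx.neg_pos2]
     ring)

/-- The elementary transvection `T_{ij}(y) = 1 + e_{ij} y - e_{-j,-i} y`, `i ≠ ±j`. -/
def T₂ (q₀ : QuadraticForm K M₀) (i j : Idx) (h₁ : i ≠ j) (h₂ : i ≠ -j) (y : K) : orth q₀ :=
  ⟨LinearEquiv.ofLinearMap (rootMap M₀ i j y) (rootMap M₀ i j (-y))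
      (rootMap_comp i j h₁ h₂ _ _ (add_neg_cancel y))
      (rootMap_comp i j h₁ h₂ _ _ (neg_add_cancel y)),
    fun v => form_rootMap q₀ i j h₁ h₂ y v⟩

/-- The elementary transvection `T_i(u) = 1 + e_{0,i} u - e_{-i,0} u^* - e_{-i,i} q₀(u)`. -/
def T₁ (q₀ : QuadraticForm K M₀) (i : Idx) (u : M₀) : orth q₀ :=
  ⟨LinearEquiv.ofLinearMap (shortMap q₀ i u) (shortMap q₀ i (-u))
      (shortMap_comp q₀ i _ _ (add_neg_cancel u))
      (shortMap_comp q₀ i _ _ (neg_add_cancel u)),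
    fun v => form_shortMap q₀ i u v⟩

/-- The elementary transvections `T_{ij}(y)`, `T_i(u)` with `y ∈ I`, `u ∈ N₀`. -/
def transvections (q₀ : QuadraticForm K M₀) (N₀ : Submodule K M₀) (I : Ideal K) :
    Set (orth q₀) :=
  {t | (∃ (i j : Idx) (h₁ : i ≠ j) (h₂ : i ≠ -j), ∃ y ∈ I, t = T₂ q₀ i j h₁ h₂ y) ∨
    ∃ i : Idx, ∃ u ∈ N₀, t = T₁ q₀ i u}

/-- The elementary subgroup `EO(M, q) ≤ O(M, q)`. -/
def elem (q₀ : QuadraticForm K M₀) : Subgroup (orth q₀) :=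
  Subgroup.closure (transvections q₀ ⊤ ⊤)

/-! ## Relative subgroups -/

/-- `(N₀, I)` is admissible: `M₀ I ≤ N₀` and `b_{q₀}(M₀, N₀) + q₀(N₀) ⊆ I`. -/
structure Admissible (q₀ : QuadraticForm K M₀) (N₀ : Submodule K M₀) (I : Ideal K) : Prop where
  smul_le : I • (⊤ : Submodule K M₀) ≤ N₀
  polar_mem : ∀ u : M₀, ∀ w ∈ N₀, QuadraticMap.polar q₀ u w ∈ I
  form_mem : ∀ w ∈ N₀, q₀ w ∈ I

/-- `N = e₋₂I ⊕ e₋₁I ⊕ N₀ ⊕ e₁I ⊕ e₂I ≤ M`. -/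
def level (N₀ : Submodule K M₀) (I : Ideal K) : Submodule K (Mod K M₀) :=
  (Submodule.pi Set.univ fun _ => I).prod N₀

/-- `O(M, q, N₀, I) = {φ ∈ O(M, q) | φ(v) ≡ v (mod N) for all v ∈ M}`. -/
def relOrth (q₀ : QuadraticForm K M₀) (N₀ : Submodule K M₀) (I : Ideal K) :
    Subgroup (orth q₀) where
  carrier := {φ | ∀ v : Mod K M₀, φ.1 v - v ∈ level N₀ I}
  one_mem' := fun v => by simp
  mul_mem' := fun {φ ψ} hφ hψ v => by
    have h := add_mem (hφ (ψ.1 v)) (hψ v)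
    rwa [sub_add_sub_cancel] at h
  inv_mem' := fun {φ} hφ v => by
    have h := neg_mem (hφ (φ.1⁻¹ v))
    have h' : φ.1 (φ.1⁻¹ v) = v := φ.1.apply_symm_apply v
    rwa [h', neg_sub] at h

/-- `EO(M, q, N₀, I)`: the subgroup generated by all `EO(M, q)`-conjugates of the transvections
`T_{ij}(y)`, `T_i(u)` with `y ∈ I`, `u ∈ N₀`. -/
def relElem (q₀ : QuadraticForm K M₀) (N₀ : Submodule K M₀) (I : Ideal K) :
    Subgroup (orth q₀) :=
  Subgroup.closure {x | ∃ g ∈ elem q₀, ∃ t ∈ transvections q₀ N₀ I, x = g * t * g⁻¹}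

end OddOrth

/-! Write `T(f, u)` for the transvection `esd`, with `f` isotropic and `u ⊥ f`. The generators of
`EO(M, q)` are the `T(e_i, u)` with `u` a multiple of some `e_j`, `j ≠ ±i`, or `u ∈ M₀`, and
conjugation by `g` turns `T(f, u)` into `T(g f, g u)`. Everything rests on three facts.

Absolute normality (`elem_normal`). Let `f` be isotropic with `b(f, f') = 1`. Each `u ⊥ f` is the
Koszul vector `b(f, f') u - b(f, u) f'`, so it suffices that all Koszul vectors of `f` give
elementary transvections. By bilinearity these reduce to pairs of basis vectors and elements of
`M₀`. The pair `e_i, e_j` with `i ≠ ±j` is handled directly, and the others follow by moving this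
pair with elementary isometries and by the cyclic relation. The only input on `q₀` is that its
values generate the unit ideal, which semiregularity implies because `P_n` has no constant term.

Invariance of `N` (`apply_mem_level`). An isometry keeps the vectors of `N₀` orthogonal to `M`
modulo `I`. Where `P_n(u)` is invertible, the kernel of the Gram matrix modulo `I` behaves like a
rank one module: the columns of the adjugate are proportional to any kernel vector, and the entries
of the adjugate generate an ideal containing `P_n(u)`. So an endomorphism sending a kernel vector to
the kernel acts on it locally as a scalar and cannot lead out of `N₀`.

Relativization (`relElem_normal`, `commutator_le_relElem`). Over the fibre product `K ×_{K/I} K`,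
with module `M₀ ×_{M₀/N₀} M₀`, the values of the doubled form still generate the unit ideal, so its
elementary group is normal. An element of that group acting as `(1, z)` has `z` in `EO(M, q, N₀,
I)`. Conjugating a lift of `(1, t)` by `(g, g)` gives normality, where `(g, g)` lifts because `g`
preserves `N`; the commutator of `(t, t)` with `(1, g)` gives the second claim. -/

namespace OddOrth

/-! ### Identities for transvections and Koszul vectors -/

section Transvections

variable {K V : Type*} [CommRing K] [AddCommGroup V] [Module K V] (Q : QuadraticForm K V)

open QuadraticMap (polar)

/-- The Eichler–Siegel–Dickson transvection
`v ↦ v + b(f, v) u - b(u, v) f - Q(u) b(f, v) f`. -/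
def esd (f u : V) : V →ₗ[K] V :=
  LinearMap.id + (Q.polarBilin f).smulRight u - (Q.polarBilin u).smulRight f
    - Q u • (Q.polarBilin f).smulRight f

theorem esd_apply (f u v : V) :
    esd Q f u v = v + polar Q f v • u - polar Q u v • f - (Q u * polar Q f v) • f := by
  simp [esd, mul_smul]

theorem esd_smul_left (a : K) (f u : V) : esd Q (a • f) u = esd Q f (a • u) := by
  ext v
  simp only [esd_apply, QuadraticMap.polar_smul_left, QuadraticMap.map_smul, smul_eq_mul]
  module

theorem esd_zero (f : V) : esd Q f 0 = LinearMap.id := by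
  ext v
  simp [esd_apply, QuadraticMap.polar_zero_left]

theorem esd_comp_esd {f u w : V} (hf : Q f = 0) (hu : polar Q f u = 0) (hw : polar Q f w = 0) :
    esd Q f u ∘ₗ esd Q f w = esd Q f (u + w) := by
  have hff : polar Q f f = 0 := by simp [QuadraticMap.polar_self, hf]
  have hu' : polar Q u f = 0 := by rw [QuadraticMap.polar_comm, hu]
  ext v
  simp only [LinearMap.comp_apply, esd_apply, QuadraticMap.polar_add_right,
    QuadraticMap.polar_sub_right, QuadraticMap.polar_smul_right, QuadraticMap.polar_add_left,
    hff, hw, hu', QuadraticMap.map_add Q u w, smul_eq_mul]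
  module

theorem esd_swap {f u : V} (hf : Q f = 0) (hu : Q u = 0) : esd Q f u = esd Q u (-f) := by
  ext v
  simp only [esd_apply, QuadraticMap.polar_neg_left, QuadraticMap.map_neg, hf, hu]
  module

theorem polar_apply_apply {g : V →ₗ[K] V} (hg : ∀ v, Q (g v) = Q v) (x y : V) :
    polar Q (g x) (g y) = polar Q x y := by
  simp only [polar, ← map_add, hg]

theorem comp_esd {g : V →ₗ[K] V} (hg : ∀ v, Q (g v) = Q v) (f u : V) :
    g ∘ₗ esd Q f u = esd Q (g f) (g u) ∘ₗ g := by
  ext v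
  simp only [LinearMap.comp_apply, esd_apply, polar_apply_apply Q hg, hg, map_add, map_sub,
    map_smul]

theorem esd_add_left {f f' m : V} (hf : Q f = 0) (hf' : Q f' = 0) (hff' : polar Q f f' = 0)
    (h : polar Q f m = 0) (h' : polar Q f' m = 0) :
    esd Q f m ∘ₗ esd Q f' m ∘ₗ esd Q f (-(Q m) • f') = esd Q (f + f') m := by
  have h1 : polar Q f f = 0 := by simp [QuadraticMap.polar_self, hf]
  have h2 : polar Q f' f' = 0 := by simp [QuadraticMap.polar_self, hf']
  have h3 : polar Q m m = 2 * Q m := by simp [QuadraticMap.polar_self]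
  have h4 := QuadraticMap.polar_comm Q f' f
  have h5 := QuadraticMap.polar_comm Q m f
  have h6 := QuadraticMap.polar_comm Q m f'
  ext v
  simp only [LinearMap.comp_apply, esd_apply, QuadraticMap.polar_add_right,
    QuadraticMap.polar_sub_right, QuadraticMap.polar_smul_right, QuadraticMap.polar_add_left,
    QuadraticMap.polar_smul_left, QuadraticMap.map_smul,
    h1, h2, h3, h4, h5, h6, hf', hff', h, h', smul_eq_mul]
  module

/-- Behind this is the bivector identity `(e + y m) ∧ (e' + x m) = e ∧ e' + (x e - y e') ∧ m`. The
prescribed products with `m` make `e + y m` and `e' + x m` isotropic and `m` orthogonal to `x e - y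
e'`. -/
theorem esd_wedge {e e' m : V} {c x y : K} (he : Q e = 0) (he' : Q e' = 0)
    (hee' : polar Q e e' = 0) (hm : Q m = c) (h : polar Q e m = -c * y)
    (h' : polar Q e' m = -c * x) (a : K) :
    esd Q (e + y • m) (a • (e' + x • m)) =
      esd Q e (a • e') ∘ₗ esd Q (x • e - y • e') (a • m) := by
  have h1 : polar Q e e = 0 := by simp [QuadraticMap.polar_self, he]
  have h2 : polar Q e' e' = 0 := by simp [QuadraticMap.polar_self, he']
  have h4 := QuadraticMap.polar_comm Q e' e
  have h7 : Q (e' + x • m) = 0 := by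
    rw [QuadraticMap.map_add Q, QuadraticMap.map_smul, QuadraticMap.polar_smul_right, he', h', hm]
    simp only [smul_eq_mul]
    ring
  ext v
  simp only [LinearMap.comp_apply, esd_apply, QuadraticMap.polar_add_right,
    QuadraticMap.polar_sub_right, QuadraticMap.polar_sub_left,
    QuadraticMap.polar_smul_right, QuadraticMap.polar_add_left, h7, mul_zero, zero_mul,
    QuadraticMap.polar_smul_left, QuadraticMap.map_smul,
    h1, h2, h4, he', hee', h, h', hm, smul_eq_mul]
  module

/-- The Koszul vector `b(f, x) y - b(f, y) x`. -/
def koszul (f x y : V) : V := polar Q f x • y - polar Q f y • x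

theorem koszul_swap (f x y : V) : koszul Q f y x = -koszul Q f x y := by
  simp only [koszul]
  module

theorem koszul_add_left (f x x' y : V) :
    koszul Q f (x + x') y = koszul Q f x y + koszul Q f x' y := by
  simp only [koszul, QuadraticMap.polar_add_right]
  module

theorem koszul_add_right (f x y y' : V) :
    koszul Q f x (y + y') = koszul Q f x y + koszul Q f x y' := by
  simp only [koszul, QuadraticMap.polar_add_right]
  module

theorem koszul_smul_left (f x y : V) (a : K) :
    koszul Q f (a • x) y = a • koszul Q f x y := by
  simp only [koszul, QuadraticMap.polar_smul_right, smul_eq_mul]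
  module

theorem koszul_smul_right (f x y : V) (a : K) :
    koszul Q f x (a • y) = a • koszul Q f x y := by
  simp only [koszul, QuadraticMap.polar_smul_right, smul_eq_mul]
  module

/-- Trades a Koszul vector of a difficult pair `y, z`, once multiplied by `b(f, x)`, for those of
pairs involving `x`. -/
theorem koszul_cyclic (f x y z : V) :
    polar Q f x • koszul Q f y z = polar Q f y • koszul Q f x z - polar Q f z • koszul Q f x y := by
  simp only [koszul]
  module

theorem apply_koszul {g : V →ₗ[K] V} (hg : ∀ v, Q (g v) = Q v) (f x y : V) :
    g (koszul Q f x y) = koszul Q (g f) (g x) (g y) := by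
  simp only [koszul, polar_apply_apply Q hg, map_sub, map_smul]

end Transvections

/-! ### Elementary transvections along pairs of hyperbolic vectors -/

section Elementary

open QuadraticMap (polar)

/-- The indices `i`, `j` satisfy `i ≠ ±j`. -/
def Idx.Indep (i j : Idx) : Prop := i ≠ j ∧ i ≠ -j

theorem Idx.neg_neg (i : Idx) : - -i = i := by cases i <;> rfl

theorem Idx.Indep.symm {i j : Idx} (h : i.Indep j) : j.Indep i :=
  ⟨h.1.symm, fun h' => h.2 (by rw [h', Idx.neg_neg])⟩

theorem Idx.Indep.neg_right {i j : Idx} (h : i.Indep j) : i.Indep (-j) :=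
  ⟨h.2, by rw [Idx.neg_neg]; exact h.1⟩

theorem Idx.Indep.neg_left {i j : Idx} (h : i.Indep j) : (-i).Indep j :=
  h.symm.neg_right.symm

theorem Idx.exists_indep (i : Idx) : ∃ j, i.Indep j := by
  cases i
  · exact ⟨.pos1, ⟨(fun h => nomatch h), (fun h => nomatch h)⟩⟩
  · exact ⟨.pos2, ⟨(fun h => nomatch h), (fun h => nomatch h)⟩⟩
  · exact ⟨.pos2, ⟨(fun h => nomatch h), (fun h => nomatch h)⟩⟩
  · exact ⟨.pos1, ⟨(fun h => nomatch h), (fun h => nomatch h)⟩⟩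

variable {K : Type*} [CommRing K] {M₀ : Type*} [AddCommGroup M₀] [Module K M₀]
  (q₀ : QuadraticForm K M₀)

/-- The hyperbolic basis vectors `e_i`. -/
def hyp (K M₀ : Type*) [CommRing K] [AddCommGroup M₀] (i : Idx) : Mod K M₀ := (Pi.single i 1, 0)

theorem polar_form (v w : Mod K M₀) : polar (form q₀) v w = polar q₀ v.2 w.2 +
    (v.1 .neg1 * w.1 .pos1 + v.1 .pos1 * w.1 .neg1) +
    (v.1 .neg2 * w.1 .pos2 + v.1 .pos2 * w.1 .neg2) := by
  simp only [polar, form_apply, Prod.fst_add, Prod.snd_add, Pi.add_apply]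
  ring

theorem polar_hyp (i : Idx) (v : Mod K M₀) : polar (form q₀) (hyp K M₀ i) v = v.1 (-i) := by
  cases i <;> simp [polar_form, hyp, Idx.neg_neg2, Idx.neg_neg1, Idx.neg_pos1, Idx.neg_pos2]

theorem polar_hyp_hyp_neg (i : Idx) : polar (form q₀) (hyp K M₀ i) (hyp K M₀ (-i)) = 1 := by
  rw [polar_hyp]
  exact Pi.single_eq_same _ _

theorem polar_hyp_hyp {i j : Idx} (h : i.Indep j) :
    polar (form q₀) (hyp K M₀ i) (hyp K M₀ j) = 0 := by
  rw [polar_hyp]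
  exact Pi.single_eq_of_ne h.neg_left.1 _

theorem polar_hyp_inr (i : Idx) (m : M₀) :
    polar (form q₀) (hyp K M₀ i) (0, m) = 0 := by
  simp [polar_hyp]

theorem polar_inr (m : M₀) (v : Mod K M₀) :
    polar (form q₀) (0, m) v = polar q₀ m v.2 := by
  simp [polar_form]

theorem form_hyp (i : Idx) : form q₀ (hyp K M₀ i) = 0 := by
  cases i <;> simp [form_apply, hyp]

theorem form_inr (m : M₀) : form q₀ ((0, m) : Mod K M₀) = q₀ m := by
  simp [form_apply]

theorem polar_hyp_self (i : Idx) :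
    polar (form q₀) (hyp K M₀ i) (hyp K M₀ i) = 0 := by
  simp [QuadraticMap.polar_self, form_hyp]

theorem hyp_decomp {i j : Idx} (h : i.Indep j) (v : Mod K M₀) :
    v = v.1 i • hyp K M₀ i + v.1 j • hyp K M₀ j + (0, v.2) +
      (v.1 (-i) • hyp K M₀ (-i) + v.1 (-j) • hyp K M₀ (-j)) := by
  obtain ⟨h₁, h₂⟩ := h
  refine Prod.ext (funext fun k => ?_) (by simp [hyp])
  cases i <;> cases j <;> first
    | exact absurd rfl h₁
    | exact absurd rfl h₂
    | (cases k <;> simp [hyp, Idx.neg_neg2, Idx.neg_neg1, Idx.neg_pos1, Idx.neg_pos2])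

/-- The linear map `φ` belongs to `EO(M, q)`. -/
def InElem (φ : Mod K M₀ →ₗ[K] Mod K M₀) : Prop := ∃ g ∈ elem q₀, (g.1 : _ →ₗ[K] _) = φ

variable {q₀}

theorem InElem.comp {φ ψ : Mod K M₀ →ₗ[K] Mod K M₀} (hφ : InElem q₀ φ) (hψ : InElem q₀ ψ) :
    InElem q₀ (φ ∘ₗ ψ) := by
  obtain ⟨g, hg, rfl⟩ := hφ
  obtain ⟨h, hh, rfl⟩ := hψ
  exact ⟨g * h, mul_mem hg hh, rfl⟩

variable (q₀) in
theorem InElem.id : InElem q₀ LinearMap.id := ⟨1, one_mem _, rfl⟩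

theorem InElem.isometry {φ : Mod K M₀ →ₗ[K] Mod K M₀} (hφ : InElem q₀ φ) (v : Mod K M₀) :
    form q₀ (φ v) = form q₀ v := by
  obtain ⟨g, -, rfl⟩ := hφ
  exact g.2 v

theorem InElem.conj {φ ψ χ : Mod K M₀ →ₗ[K] Mod K M₀} (hφ : InElem q₀ φ) (hψ : InElem q₀ ψ)
    (h : φ ∘ₗ ψ = χ ∘ₗ φ) : InElem q₀ χ := by
  obtain ⟨g, hg, rfl⟩ := hφ
  obtain ⟨t, ht, rfl⟩ := hψ
  refine ⟨g * t * g⁻¹, mul_mem (mul_mem hg ht) (inv_mem hg), LinearMap.ext fun v => ?_⟩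
  have := LinearMap.congr_fun h (g.1⁻¹ v)
  simp only [LinearMap.comp_apply, LinearEquiv.coe_coe] at this
  rw [show g.1 (g.1⁻¹ v) = v from g.1.apply_symm_apply v] at this
  exact this

theorem InElem.of_comp_right {φ ψ : Mod K M₀ →ₗ[K] Mod K M₀} (hφ : InElem q₀ φ)
    (h : InElem q₀ (φ ∘ₗ ψ)) : InElem q₀ ψ := by
  obtain ⟨g, hg, rfl⟩ := hφ
  obtain ⟨t, ht, h⟩ := h
  refine ⟨g⁻¹ * t, mul_mem (inv_mem hg) ht, LinearMap.ext fun v => ?_⟩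
  have := LinearMap.congr_fun h v
  change g.1⁻¹ (t.1 v) = ψ v
  rw [show t.1 v = g.1 (ψ v) from this]
  exact g.1.symm_apply_apply _

theorem T₁_coe (i : Idx) (u : M₀) :
    ((T₁ q₀ i u).1 : Mod K M₀ →ₗ[K] Mod K M₀) = esd (form q₀) (hyp K M₀ (-i)) (0, u) := by
  refine LinearMap.ext fun v => ?_
  rw [esd_apply, polar_hyp, polar_inr, form_inr, Idx.neg_neg]
  change shortMap q₀ i u v = _
  simp only [shortMap, LinearMap.coe_mk, AddHom.coe_mk, hyp]
  ext k
  · simp [Pi.single_apply]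
  · simp

theorem T₂_coe (i j : Idx) (h₁ : i ≠ j) (h₂ : i ≠ -j) (y : K) :
    ((T₂ q₀ i j h₁ h₂ y).1 : Mod K M₀ →ₗ[K] Mod K M₀) =
      esd (form q₀) (hyp K M₀ (-j)) (y • hyp K M₀ i) := by
  refine LinearMap.ext fun v => ?_
  rw [esd_apply, QuadraticMap.polar_smul_left, QuadraticMap.map_smul, polar_hyp, polar_hyp,
    form_hyp, Idx.neg_neg]
  change rootMap M₀ i j y v = _
  simp only [rootMap, LinearMap.coe_mk, AddHom.coe_mk, hyp]
  ext k
  · simp [Pi.single_apply]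
    split_ifs <;> ring
  · simp

/-- The vectors `u ⊥ f` such that all transvections `T(f, a u)` are elementary. -/
def elemOrtho {f : Mod K M₀} (hf : form q₀ f = 0) : Submodule K (Mod K M₀) where
  -- The quantifier over `a` gives closure under scalars; closure under sums is `T(f, u) T(f, w) =
  -- T(f, u + w)`.
  carrier := {u | polar (form q₀) f u = 0 ∧ ∀ a : K, InElem q₀ (esd (form q₀) f (a • u))}
  zero_mem' := ⟨QuadraticMap.polar_zero_right _ _, fun a => by
    rw [smul_zero, esd_zero]; exact InElem.id q₀⟩
  add_mem' := fun {u w} hu hw => ⟨by rw [QuadraticMap.polar_add_right, hu.1, hw.1, add_zero],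
    fun a => by
      rw [smul_add, ← esd_comp_esd (form q₀) hf
        (by rw [QuadraticMap.polar_smul_right, hu.1, smul_zero])
        (by rw [QuadraticMap.polar_smul_right, hw.1, smul_zero])]
      exact (hu.2 a).comp (hw.2 a)⟩
  smul_mem' := fun c u hu => ⟨by rw [QuadraticMap.polar_smul_right, hu.1, smul_zero],
    fun a => by rw [smul_smul]; exact hu.2 _⟩

theorem mem_elemOrtho {f : Mod K M₀} (hf : form q₀ f = 0) {u : Mod K M₀} :
    u ∈ elemOrtho hf ↔
      polar (form q₀) f u = 0 ∧ ∀ a : K, InElem q₀ (esd (form q₀) f (a • u)) := Iff.rfl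

/-- For two isotropic vectors `T(f, u) = T(u, -f)`. -/
theorem mem_elemOrtho_swap {f u : Mod K M₀} (hf : form q₀ f = 0) (hu : form q₀ u = 0)
    (h : u ∈ elemOrtho hf) : f ∈ elemOrtho hu := by
  refine ⟨by rw [QuadraticMap.polar_comm, h.1], fun a => ?_⟩
  rw [← esd_smul_left, esd_swap _ (by rw [QuadraticMap.map_smul, hu, smul_zero]) hf,
    ← neg_one_smul K (a • u), smul_smul]
  exact h.2 _

theorem mem_elemOrtho_apply {f u : Mod K M₀} (hf : form q₀ f = 0) (h : u ∈ elemOrtho hf)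
    {φ : Mod K M₀ →ₗ[K] Mod K M₀} (hφ : InElem q₀ φ) (hφf : form q₀ (φ f) = 0) :
    φ u ∈ elemOrtho hφf := by
  refine ⟨by rw [polar_apply_apply _ hφ.isometry, h.1], fun a => ?_⟩
  refine hφ.conj (h.2 a) ?_
  rw [comp_esd _ hφ.isometry, map_smul]

theorem self_mem_elemOrtho {f : Mod K M₀} (hf : form q₀ f = 0) : f ∈ elemOrtho hf := by
  have hff : polar (form q₀) f f = 0 := by simp [QuadraticMap.polar_self, hf]
  refine ⟨hff, fun a => ?_⟩
  have : esd (form q₀) f (a • f) = LinearMap.id := by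
    refine LinearMap.ext fun v => ?_
    simp only [esd_apply, QuadraticMap.polar_smul_left, QuadraticMap.map_smul, hf, smul_eq_mul,
      LinearMap.id_apply]
    module
  rw [this]
  exact InElem.id q₀

theorem inr_mem_elemOrtho_hyp (i : Idx) (m : M₀) : (0, m) ∈ elemOrtho (form_hyp q₀ i) := by
  refine ⟨polar_hyp_inr q₀ i m, fun a => ⟨T₁ q₀ (-i) (a • m),
    Subgroup.subset_closure (Or.inr ⟨_, _, trivial, rfl⟩), ?_⟩⟩
  rw [T₁_coe, Idx.neg_neg, Prod.smul_mk, smul_zero]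

theorem hyp_mem_elemOrtho_hyp {i j : Idx} (h : i.Indep j) :
    hyp K M₀ j ∈ elemOrtho (form_hyp q₀ i) := by
  refine ⟨polar_hyp_hyp q₀ h, fun a => ⟨T₂ q₀ j (-i) h.symm.neg_right.1 h.symm.neg_right.2 a,
    Subgroup.subset_closure (Or.inl ⟨_, _, _, _, a, trivial, rfl⟩), ?_⟩⟩
  rw [T₂_coe, Idx.neg_neg]

theorem mem_elemOrtho_hyp {i : Idx} {u : Mod K M₀} (hu : polar (form q₀) (hyp K M₀ i) u = 0) :
    u ∈ elemOrtho (form_hyp q₀ i) := by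
  obtain ⟨j, hij⟩ := i.exists_indep
  rw [hyp_decomp hij u]
  rw [polar_hyp] at hu
  rw [hu, zero_smul, zero_add]
  exact add_mem (add_mem (add_mem (Submodule.smul_mem _ _ (self_mem_elemOrtho _))
    (Submodule.smul_mem _ _ (hyp_mem_elemOrtho_hyp hij))) (inr_mem_elemOrtho_hyp i _))
    (Submodule.smul_mem _ _ (hyp_mem_elemOrtho_hyp hij.neg_right))

theorem form_pair {i j : Idx} (h : i.Indep j) (x y : K) :
    form q₀ (x • hyp K M₀ i + y • hyp K M₀ j) = 0 := by
  rw [QuadraticMap.map_add (form q₀), QuadraticMap.map_smul, QuadraticMap.map_smul,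
    QuadraticMap.polar_smul_left, QuadraticMap.polar_smul_right, form_hyp, form_hyp,
    polar_hyp_hyp q₀ h]
  simp

theorem polar_pair_inr (i j : Idx) (x y : K) (m : M₀) :
    polar (form q₀) (x • hyp K M₀ i + y • hyp K M₀ j) (0, m) = 0 := by
  rw [QuadraticMap.polar_add_left, QuadraticMap.polar_smul_left, QuadraticMap.polar_smul_left,
    polar_hyp_inr, polar_hyp_inr]
  simp

theorem hyp_mem_elemOrtho_pair {i j : Idx} (h : i.Indep j) (x y : K) :
    hyp K M₀ i ∈ elemOrtho (form_pair (q₀ := q₀) (M₀ := M₀) h x y) := by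
  refine mem_elemOrtho_swap (form_hyp q₀ i) _ (mem_elemOrtho_hyp ?_)
  rw [QuadraticMap.polar_add_right, QuadraticMap.polar_smul_right, QuadraticMap.polar_smul_right,
    polar_hyp_self, polar_hyp_hyp q₀ h]
  simp

theorem hyp_mem_elemOrtho_pair' {i j : Idx} (h : i.Indep j) (x y : K) :
    hyp K M₀ j ∈ elemOrtho (form_pair (q₀ := q₀) (M₀ := M₀) h x y) := by
  refine mem_elemOrtho_swap (form_hyp q₀ j) _ (mem_elemOrtho_hyp ?_)
  rw [QuadraticMap.polar_add_right, QuadraticMap.polar_smul_right, QuadraticMap.polar_smul_right,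
    polar_hyp_self, polar_hyp_hyp q₀ h.symm]
  simp

/-- `esd_add_left` splits the transvection along `x e_i + y e_j` into ones along `e_i` and `e_j`,
after the coefficients are moved into the second argument. -/
theorem inr_mem_elemOrtho_pair {i j : Idx} (h : i.Indep j) (x y : K) (m : M₀) :
    (0, m) ∈ elemOrtho (form_pair (q₀ := q₀) (M₀ := M₀) h x y) := by
  refine ⟨polar_pair_inr i j x y m, fun a => ?_⟩
  have hs : ∀ (k : Idx) (c : K), form q₀ (c • hyp K M₀ k) = 0 := fun k c => by
    rw [QuadraticMap.map_smul, form_hyp, smul_zero]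
  have ho : ∀ (k : Idx) (c : K), polar (form q₀) (c • hyp K M₀ k) (a • (0, m)) = 0 := fun k c => by
    rw [QuadraticMap.polar_smul_left, QuadraticMap.polar_smul_right, polar_hyp_inr]
    simp
  rw [← esd_add_left (form q₀) (hs i x) (hs j y)
    (by rw [QuadraticMap.polar_smul_left, QuadraticMap.polar_smul_right, polar_hyp_hyp q₀ h]; simp)
    (ho i x) (ho j y), esd_smul_left, esd_smul_left, esd_smul_left, smul_smul, smul_smul,
    smul_smul, smul_smul]
  exact ((inr_mem_elemOrtho_hyp i m).2 _).comp (((inr_mem_elemOrtho_hyp j m).2 _).comp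
    ((hyp_mem_elemOrtho_hyp h).2 _))

/-- The ideal generated by the values of `q₀`. -/
def valueIdeal (q₀ : QuadraticForm K M₀) : Ideal K := Ideal.span (Set.range q₀)

/-- The one place of the absolute argument where the values of `q₀` enter directly. Conjugating
`T(e_i, a e_j)` by `T(w, m)` yields, through `esd_wedge`, an elementary transvection along `x e_i -
y e_j` with vector `a (m - q₀(m) w)`. As `m` itself is already available, so is `q₀(m) w`. -/
theorem pair_mem_elemOrtho_pair (hv : valueIdeal q₀ = ⊤) {i j : Idx} (h : i.Indep j) (x y : K) :
    y • hyp K M₀ (-i) + x • hyp K M₀ (-j) ∈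
      elemOrtho (form_pair (q₀ := q₀) (M₀ := M₀) h x (-y)) := by
  set w := y • hyp K M₀ (-i) + x • hyp K M₀ (-j) with hw
  have hn := h.neg_left.neg_right
  have hfw : form q₀ w = 0 := form_pair hn y x
  have hiw : polar (form q₀) (hyp K M₀ i) w = y := by
    rw [hw, QuadraticMap.polar_add_right, QuadraticMap.polar_smul_right,
      QuadraticMap.polar_smul_right, polar_hyp_hyp_neg, polar_hyp_hyp q₀ h.neg_right]
    simp
  have hjw : polar (form q₀) (hyp K M₀ j) w = x := by
    rw [hw, QuadraticMap.polar_add_right, QuadraticMap.polar_smul_right,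
      QuadraticMap.polar_smul_right, polar_hyp_hyp_neg, polar_hyp_hyp q₀ h.symm.neg_right]
    simp
  have hwm : ∀ m : M₀, polar (form q₀) w (0, m) = 0 := polar_pair_inr _ _ _ _
  -- The scalars multiplying `w` into a submodule form an ideal; if it contains all values of `q₀`,
  -- it contains `1`.
  suffices hJ : ∀ m : M₀, q₀ m • w ∈ elemOrtho (form_pair (q₀ := q₀) (M₀ := M₀) h x (-y)) by
    have hle : valueIdeal q₀ ≤ (elemOrtho (form_pair (q₀ := q₀) (M₀ := M₀) h x (-y))).comap
        (LinearMap.toSpanSingleton K _ w) := by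
      rw [valueIdeal, Ideal.span_le]
      rintro _ ⟨m, rfl⟩
      exact hJ m
    rw [hv] at hle
    simpa using hle (Submodule.mem_top (x := (1 : K)))
  intro m
  set c := q₀ m with hc
  -- Chosen so that `T(w, m)` moves `e_i` to `e_i + y m'` and `e_j` to `e_j + x m'`.
  set m' : Mod K M₀ := (0, m) - c • w with hm'
  have hm'i : polar (form q₀) (hyp K M₀ i) m' = -c * y := by
    rw [hm', QuadraticMap.polar_sub_right, QuadraticMap.polar_smul_right, hiw, polar_hyp_inr]
    simp
  have hm'j : polar (form q₀) (hyp K M₀ j) m' = -c * x := by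
    rw [hm', QuadraticMap.polar_sub_right, QuadraticMap.polar_smul_right, hjw, polar_hyp_inr]
    simp
  have hfm' : form q₀ m' = c := by
    rw [hm', sub_eq_add_neg, QuadraticMap.map_add (form q₀), QuadraticMap.map_neg,
      QuadraticMap.map_smul, QuadraticMap.polar_neg_right, QuadraticMap.polar_smul_right,
      QuadraticMap.polar_comm, hwm, hfw, form_inr]
    simp [hc]
  have hT : InElem q₀ (esd (form q₀) w (0, m)) := by
    have := (inr_mem_elemOrtho_pair (q₀ := q₀) hn y x m).2 1
    rwa [one_smul] at this
  have hTi : esd (form q₀) w (0, m) (hyp K M₀ i) = hyp K M₀ i + y • m' := by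
    rw [esd_apply, QuadraticMap.polar_comm, hiw, QuadraticMap.polar_comm, polar_hyp_inr, form_inr,
      hm']
    module
  have hTj : esd (form q₀) w (0, m) (hyp K M₀ j) = hyp K M₀ j + x • m' := by
    rw [esd_apply, QuadraticMap.polar_comm, hjw, QuadraticMap.polar_comm, polar_hyp_inr, form_inr,
      hm']
    module
  have hmem : m' ∈ elemOrtho (form_pair (q₀ := q₀) (M₀ := M₀) h x (-y)) := by
    refine ⟨?_, fun a => ?_⟩
    · rw [QuadraticMap.polar_add_left, QuadraticMap.polar_smul_left, QuadraticMap.polar_smul_left,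
        hm'i, hm'j, smul_eq_mul, smul_eq_mul]
      ring
    · refine ((hyp_mem_elemOrtho_hyp (q₀ := q₀) h).2 a).of_comp_right ?_
      rw [neg_smul, ← sub_eq_add_neg, ← esd_wedge (form q₀) (form_hyp q₀ i) (form_hyp q₀ j)
        (polar_hyp_hyp q₀ h) hfm' hm'i hm'j, ← hTi, ← hTj, ← map_smul]
      exact hT.conj ((hyp_mem_elemOrtho_hyp (q₀ := q₀) h).2 a) (comp_esd _ hT.isometry _ _)
  have := sub_mem (inr_mem_elemOrtho_pair (q₀ := q₀) h x (-y) m) hmem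
  rwa [hm', sub_sub_cancel] at this

/-! ### Koszul vectors and normality of the absolute elementary group -/

theorem form_koszul_hyp {i j : Idx} (h : i.Indep j) (f : Mod K M₀) :
    form q₀ (koszul (form q₀) f (hyp K M₀ i) (hyp K M₀ j)) = 0 := by
  rw [koszul, sub_eq_add_neg, ← neg_smul]
  exact form_pair h.symm _ _

/-- All Koszul vectors of `x`, `y` define elementary transvections. -/
def KoszulElem (q₀ : QuadraticForm K M₀) (x y : Mod K M₀) : Prop :=
  ∀ (f : Mod K M₀) (hf : form q₀ f = 0), koszul (form q₀) f x y ∈ elemOrtho hf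

/-- The Koszul vector lies in the totally isotropic span of `e_i, e_j`, so its role can be exchanged
with that of `f`. Then `f` is split into its components; those along `e_{-i}` and `e_{-j}` are kept
together, since only their sum is orthogonal to the Koszul vector in general. -/
theorem koszulElem_hyp (hv : valueIdeal q₀ = ⊤) {i j : Idx} (h : i.Indep j) :
    KoszulElem q₀ (hyp K M₀ i) (hyp K M₀ j) := by
  intro f hf
  refine mem_elemOrtho_swap (form_koszul_hyp h f) hf ?_
  have key : ∀ (u : Mod K M₀) (hu : form q₀ u = 0) (x y : K),
      u = x • hyp K M₀ j + (-y) • hyp K M₀ i → f.1 (-i) = x → f.1 (-j) = y →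
      f ∈ elemOrtho hu := by
    rintro u hu x y rfl hx hy
    rw [hyp_decomp h.symm f, hx, hy]
    exact add_mem (add_mem (add_mem (Submodule.smul_mem _ _ (hyp_mem_elemOrtho_pair h.symm _ _))
      (Submodule.smul_mem _ _ (hyp_mem_elemOrtho_pair' h.symm _ _)))
      (inr_mem_elemOrtho_pair h.symm _ _ _)) (pair_mem_elemOrtho_pair hv h.symm x y)
  refine key _ _ _ _ ?_ rfl rfl
  rw [koszul, QuadraticMap.polar_comm, polar_hyp, QuadraticMap.polar_comm, polar_hyp]
  module

/-- The property quantifies over all isotropic `f`, so one may replace `f` by `g⁻¹ f` and transport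
back by `g`. -/
theorem KoszulElem.apply {x y : Mod K M₀} (h : KoszulElem q₀ x y) {g : orth q₀}
    (hg : g ∈ elem q₀) : KoszulElem q₀ (g.1 x) (g.1 y) := by
  intro f hf
  have hi : InElem q₀ (g.1 : Mod K M₀ →ₗ[K] Mod K M₀) := ⟨g, hg, rfl⟩
  have hf' : form q₀ (g.1⁻¹ f) = 0 := by rw [← hf]; exact (g⁻¹).2 f
  have hgf : g.1 (g.1⁻¹ f) = f := g.1.apply_symm_apply f
  have := mem_elemOrtho_apply hf' (h _ hf') hi (by rw [LinearEquiv.coe_coe, hgf]; exact hf)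
  rw [apply_koszul _ hi.isometry] at this
  simpa only [LinearEquiv.coe_coe, hgf] using this

theorem KoszulElem.map {x y : Mod K M₀} (h : KoszulElem q₀ x y)
    {φ : Mod K M₀ →ₗ[K] Mod K M₀} (hφ : InElem q₀ φ) : KoszulElem q₀ (φ x) (φ y) := by
  obtain ⟨g, hg, rfl⟩ := hφ
  exact h.apply hg

theorem esd_hyp_inr_mem (i : Idx) (m : M₀) : InElem q₀ (esd (form q₀) (hyp K M₀ i) (0, m)) := by
  simpa using (inr_mem_elemOrtho_hyp (q₀ := q₀) i m).2 1

theorem esd_hyp_hyp_mem {i j : Idx} (h : i.Indep j) :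
    InElem q₀ (esd (form q₀) (hyp K M₀ i) (hyp K M₀ j)) := by
  simpa using (hyp_mem_elemOrtho_hyp (q₀ := q₀) h).2 1

theorem polar_hyp_neg_hyp (i : Idx) : polar (form q₀) (hyp K M₀ (-i)) (hyp K M₀ i) = 1 := by
  rw [QuadraticMap.polar_comm, polar_hyp_hyp_neg]

theorem esd_hyp_neg_inr_hyp (i : Idx) (m : M₀) :
    esd (form q₀) (hyp K M₀ (-i)) (0, m) (hyp K M₀ i) =
      hyp K M₀ i + (0, m) - q₀ m • hyp K M₀ (-i) := by
  rw [esd_apply, polar_hyp_neg_hyp, QuadraticMap.polar_comm _ (0, m), polar_hyp_inr, form_inr]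
  module

theorem esd_hyp_inr_hyp {i j : Idx} (h : i.Indep j) (m : M₀) :
    esd (form q₀) (hyp K M₀ i) (0, m) (hyp K M₀ j) = hyp K M₀ j := by
  rw [esd_apply, polar_hyp_hyp q₀ h, QuadraticMap.polar_comm _ (0, m), polar_hyp_inr]
  module

theorem esd_hyp_inr_inr (i : Idx) (m m' : M₀) :
    esd (form q₀) (hyp K M₀ i) (0, m) (0, m') = (0, m') - polar q₀ m m' • hyp K M₀ i := by
  rw [esd_apply, polar_hyp_inr, polar_inr]
  module

/-- `T(e_{-j}, m)` fixes `e_i` and sends `e_j` to `e_j + m - q₀(m) e_{-j}`; subtracting the known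
pairs `e_i, e_{±j}` isolates `e_i, m`. -/
theorem koszulElem_hyp_inr (hv : valueIdeal q₀ = ⊤) (i : Idx) (m : M₀) :
    KoszulElem q₀ (hyp K M₀ i) (0, m) := by
  intro f hf
  obtain ⟨j, h⟩ := i.exists_indep
  have := (koszulElem_hyp hv h).map (esd_hyp_inr_mem (-j) m) f hf
  rw [esd_hyp_neg_inr_hyp, esd_hyp_inr_hyp h.symm.neg_left, sub_eq_add_neg, ← neg_smul,
    koszul_add_right, koszul_add_right, koszul_smul_right] at this
  have h' := sub_mem (sub_mem this (Submodule.smul_mem _ (-q₀ m)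
    (koszulElem_hyp hv h.neg_right f hf))) (koszulElem_hyp hv h f hf)
  convert h' using 1
  abel

/-- Comes from the image of the pair `e_i, e_j` under `T(e_{-j}, e_{-i})`. This isometry reaches the
opposite pairs only in the sum. -/
theorem koszul_hyp_neg_add_mem (hv : valueIdeal q₀ = ⊤) {i j : Idx} (h : i.Indep j)
    {f : Mod K M₀} (hf : form q₀ f = 0) :
    koszul (form q₀) f (hyp K M₀ i) (hyp K M₀ (-i)) +
      koszul (form q₀) f (hyp K M₀ j) (hyp K M₀ (-j)) ∈ elemOrtho hf := by
  have := (koszulElem_hyp hv h).map (esd_hyp_hyp_mem h.symm.neg_left.neg_right) f hf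
  have h1 : esd (form q₀) (hyp K M₀ (-j)) (hyp K M₀ (-i)) (hyp K M₀ i) =
      hyp K M₀ i + (-1 : K) • hyp K M₀ (-j) := by
    rw [esd_apply, polar_hyp_neg_hyp, polar_hyp_hyp q₀ h.symm.neg_left, form_hyp]
    module
  have h2 : esd (form q₀) (hyp K M₀ (-j)) (hyp K M₀ (-i)) (hyp K M₀ j) =
      hyp K M₀ j + hyp K M₀ (-i) := by
    rw [esd_apply, polar_hyp_neg_hyp, polar_hyp_hyp q₀ h.neg_left, form_hyp]
    module
  rw [h1, h2, koszul_add_left, koszul_add_right, koszul_smul_left, koszul_add_right,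
    koszul_swap (form q₀) f (hyp K M₀ j) (hyp K M₀ (-j))] at this
  have h' := add_mem (sub_mem this (koszulElem_hyp hv h f hf))
    (koszulElem_hyp hv h.symm.neg_left.neg_right f hf)
  convert h' using 1
  module

/-- For `x = e_{±j}` or `x ∈ M₀` the cyclic relation reduces to known pairs. For `x = e_i` multiply
the sum of the two opposite Koszul vectors by `b(f, e_i)`: its `j` part is covered by the cyclic
relation, which leaves the `i` part. -/
theorem polar_smul_koszul_hyp_neg_mem (hv : valueIdeal q₀ = ⊤) (i : Idx)
    {f : Mod K M₀} (hf : form q₀ f = 0) (x : Mod K M₀) :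
    polar (form q₀) f x • koszul (form q₀) f (hyp K M₀ i) (hyp K M₀ (-i)) ∈ elemOrtho hf := by
  have h1 : ∀ {i j : Idx}, i.Indep j →
      polar (form q₀) f (hyp K M₀ j) • koszul (form q₀) f (hyp K M₀ i) (hyp K M₀ (-i)) ∈
        elemOrtho hf := by
    intro i j h
    rw [koszul_cyclic]
    exact sub_mem (Submodule.smul_mem _ _ (koszulElem_hyp hv h.symm.neg_right f hf))
      (Submodule.smul_mem _ _ (koszulElem_hyp hv h.symm f hf))
  have h2 : ∀ {i j : Idx}, i.Indep j →
      polar (form q₀) f (hyp K M₀ i) • koszul (form q₀) f (hyp K M₀ i) (hyp K M₀ (-i)) ∈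
        elemOrtho hf := by
    intro i j h
    have := sub_mem (Submodule.smul_mem _ (polar (form q₀) f (hyp K M₀ i))
      (koszul_hyp_neg_add_mem hv h hf)) (h1 h.symm)
    rwa [smul_add, add_sub_cancel_right] at this
  have h3 : ∀ {i j : Idx}, i.Indep j →
      polar (form q₀) f (hyp K M₀ (-i)) • koszul (form q₀) f (hyp K M₀ i) (hyp K M₀ (-i)) ∈
        elemOrtho hf := by
    intro i j h
    have := h2 h.neg_left
    rw [Idx.neg_neg, koszul_swap, smul_neg] at this
    exact neg_mem_iff.mp this
  have h4 : ∀ m : M₀, polar (form q₀) f (0, m) •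
      koszul (form q₀) f (hyp K M₀ i) (hyp K M₀ (-i)) ∈ elemOrtho hf := by
    intro m
    rw [koszul_cyclic, koszul_swap _ _ (hyp K M₀ (-i)), koszul_swap _ _ (hyp K M₀ i)]
    exact sub_mem (Submodule.smul_mem _ _ (neg_mem (koszulElem_hyp_inr hv _ m f hf)))
      (Submodule.smul_mem _ _ (neg_mem (koszulElem_hyp_inr hv _ m f hf)))
  obtain ⟨j, h⟩ := i.exists_indep
  rw [hyp_decomp h x]
  simp only [QuadraticMap.polar_add_right, QuadraticMap.polar_smul_right, add_smul, smul_assoc]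
  exact add_mem (add_mem (add_mem (Submodule.smul_mem _ _ (h2 h)) (Submodule.smul_mem _ _ (h1 h)))
    (h4 _)) (add_mem (Submodule.smul_mem _ _ (h3 h)) (Submodule.smul_mem _ _ (h1 h.neg_right)))

theorem koszul_hyp_neg_mem (hv : valueIdeal q₀ = ⊤) {f f' : Mod K M₀} (hf : form q₀ f = 0)
    (hff' : polar (form q₀) f f' = 1) (i : Idx) :
    koszul (form q₀) f (hyp K M₀ i) (hyp K M₀ (-i)) ∈ elemOrtho hf := by
  have := polar_smul_koszul_hyp_neg_mem hv i hf f'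
  rwa [hff', one_smul] at this

theorem koszul_hyp_hyp_mem (hv : valueIdeal q₀ = ⊤) {f f' : Mod K M₀} (hf : form q₀ f = 0)
    (hff' : polar (form q₀) f f' = 1) (i j : Idx) :
    koszul (form q₀) f (hyp K M₀ i) (hyp K M₀ j) ∈ elemOrtho hf := by
  by_cases h : j = i
  · subst h
    rw [koszul, sub_self]
    exact zero_mem _
  by_cases h' : j = -i
  · subst h'
    exact koszul_hyp_neg_mem hv hf hff' i
  · exact koszulElem_hyp hv (Idx.Indep.symm ⟨h, h'⟩) f hf

/-- `T(e_{-1}, m)` carries the pair `e_1, m'` to one whose Koszul vector contains that of `m, m'`;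
all other terms are known. -/
theorem koszul_inr_inr_mem (hv : valueIdeal q₀ = ⊤) {f f' : Mod K M₀} (hf : form q₀ f = 0)
    (hff' : polar (form q₀) f f' = 1) (m m' : M₀) :
    koszul (form q₀) f (0, m) (0, m') ∈ elemOrtho hf := by
  set e := hyp K M₀ .pos1 with he
  set e' := hyp K M₀ (-.pos1) with he'
  have h1 := (koszulElem_hyp_inr hv .pos1 m').map (esd_hyp_inr_mem (-.pos1) m) f hf
  rw [esd_hyp_neg_inr_hyp, esd_hyp_inr_inr, ← he, ← he'] at h1
  have h2 : koszul (form q₀) f e (0, m') ∈ elemOrtho hf := koszulElem_hyp_inr hv _ _ f hf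
  have h3 : koszul (form q₀) f e' (0, m') ∈ elemOrtho hf := koszulElem_hyp_inr hv _ _ f hf
  have h4 : koszul (form q₀) f e' (0, m) ∈ elemOrtho hf := koszulElem_hyp_inr hv _ _ f hf
  have h5 : koszul (form q₀) f e e' ∈ elemOrtho hf := koszul_hyp_neg_mem hv hf hff' _
  set z : Mod K M₀ := (0, m)
  set z' : Mod K M₀ := (0, m')
  have h6 : koszul (form q₀) f z z' =
      koszul (form q₀) f (e + z - q₀ m • e') (z' - polar q₀ m m' • e') -
      koszul (form q₀) f e z' + polar q₀ m m' • koszul (form q₀) f e e' -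
      polar q₀ m m' • koszul (form q₀) f e' z + q₀ m • koszul (form q₀) f e' z' := by
    simp only [koszul, QuadraticMap.polar_add_right, QuadraticMap.polar_sub_right,
      QuadraticMap.polar_smul_right, smul_eq_mul]
    module
  rw [h6]
  exact add_mem (sub_mem (add_mem (sub_mem h1 h2) (Submodule.smul_mem _ _ h5))
    (Submodule.smul_mem _ _ h4)) (Submodule.smul_mem _ _ h3)

theorem koszul_mem (hv : valueIdeal q₀ = ⊤) {f f' : Mod K M₀} (hf : form q₀ f = 0)
    (hff' : polar (form q₀) f f' = 1) (x y : Mod K M₀) :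
    koszul (form q₀) f x y ∈ elemOrtho hf := by
  have swap : ∀ {x y : Mod K M₀}, koszul (form q₀) f x y ∈ elemOrtho hf →
      koszul (form q₀) f y x ∈ elemOrtho hf := fun h => by
    rw [koszul_swap]
    exact neg_mem h
  have right : ∀ x y : Mod K M₀, (∀ i, koszul (form q₀) f x (hyp K M₀ i) ∈ elemOrtho hf) →
      (∀ m : M₀, koszul (form q₀) f x (0, m) ∈ elemOrtho hf) →
      koszul (form q₀) f x y ∈ elemOrtho hf := by
    intro x y h1 h2
    obtain ⟨j, h⟩ := Idx.pos1.exists_indep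
    rw [hyp_decomp h y]
    simp only [koszul_add_right, koszul_smul_right]
    exact add_mem (add_mem (add_mem (Submodule.smul_mem _ _ (h1 _)) (Submodule.smul_mem _ _ (h1 _)))
      (h2 _)) (add_mem (Submodule.smul_mem _ _ (h1 _)) (Submodule.smul_mem _ _ (h1 _)))
  refine right x y (fun i => swap (right _ _ (fun j => ?_) fun m => ?_))
    fun m => swap (right _ _ (fun j => swap ?_) fun m' => ?_)
  · exact koszul_hyp_hyp_mem hv hf hff' i j
  · exact koszulElem_hyp_inr hv i m f hf
  · exact koszulElem_hyp_inr hv j m f hf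
  · exact koszul_inr_inr_mem hv hf hff' m m'

theorem mem_elemOrtho_of_polar_eq_zero (hv : valueIdeal q₀ = ⊤) {f f' : Mod K M₀}
    (hf : form q₀ f = 0) (hff' : polar (form q₀) f f' = 1) {u : Mod K M₀}
    (hu : polar (form q₀) f u = 0) : u ∈ elemOrtho hf := by
  have := koszul_mem hv hf hff' f' u
  rwa [koszul, hff', hu, one_smul, zero_smul, sub_zero] at this

/-- `EO(M, q)` is normal if the values of `q₀` generate the unit ideal. -/
theorem elem_normal (hv : valueIdeal q₀ = ⊤) : (elem q₀).Normal := by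
  have key : ∀ (g t : orth q₀) (i : Idx) (u : Mod K M₀), polar (form q₀) (hyp K M₀ i) u = 0 →
      (t.1 : Mod K M₀ →ₗ[K] Mod K M₀) = esd (form q₀) (hyp K M₀ i) u →
      g * t * g⁻¹ ∈ elem q₀ := by
    intro g t i u hu ht
    have hg : ∀ v, form q₀ ((g.1 : Mod K M₀ →ₗ[K] Mod K M₀) v) = form q₀ v := g.2
    have hf : form q₀ (g.1 (hyp K M₀ i)) = 0 := by rw [g.2, form_hyp]
    -- The image of `e_{-i}` witnesses that `g e_i` is unimodular.
    have h1 := (mem_elemOrtho_of_polar_eq_zero hv hf (f' := g.1 (hyp K M₀ (-i)))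
      (by rw [← polar_hyp_hyp_neg q₀ i]; exact polar_apply_apply _ hg _ _) (u := g.1 u)
      (by rw [← hu]; exact polar_apply_apply _ hg _ _)).2 1
    rw [one_smul] at h1
    obtain ⟨s, hs, hs'⟩ := h1
    have : g * t = s * g := by
      refine Subtype.ext (LinearEquiv.toLinearMap_injective ?_)
      change g.1.toLinearMap ∘ₗ t.1.toLinearMap = s.1.toLinearMap ∘ₗ g.1.toLinearMap
      rw [ht, hs', comp_esd _ hg]
      rfl
    rwa [this, mul_inv_cancel_right]
  refine ⟨fun t ht g => ?_⟩
  induction ht using Subgroup.closure_induction with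
  | mem t ht =>
    rcases ht with ⟨i, j, h₁, h₂, y, -, rfl⟩ | ⟨i, u, -, rfl⟩
    · refine key g _ (-j) (y • hyp K M₀ i) ?_ (T₂_coe i j h₁ h₂ y)
      rw [QuadraticMap.polar_smul_right, polar_hyp_hyp q₀ (Idx.Indep.neg_left (Idx.Indep.symm
        ⟨h₁, h₂⟩)), smul_zero]
    · exact key g _ (-i) (0, u) (polar_hyp_inr q₀ _ _) (T₁_coe i u)
  | one => rw [mul_one, mul_inv_cancel]; exact one_mem _
  | mul s t _ _ hs ht =>
    have := mul_mem hs ht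
    rwa [show g * s * g⁻¹ * (g * t * g⁻¹) = g * (s * t) * g⁻¹ by group] at this
  | inv t _ ht =>
    have := inv_mem ht
    rwa [show (g * t * g⁻¹)⁻¹ = g * t⁻¹ * g⁻¹ by group] at this

end Elementary

/-! ### The half-determinant and the adjugate of the Gram matrix -/

section Semidiscriminant

open QuadraticMap (polar polarSym2)

theorem sum_sum_sym2 {ι R : Type*} [AddCommGroup R] [DecidableEq ι] (s : Finset ι)
    (f : Sym2 ι → R) :
    ∑ i ∈ s, ∑ j ∈ s, f s(i, j) = 2 • ∑ x ∈ s.sym2, f x - ∑ i ∈ s, f s(i, i) := by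
  induction s using Finset.cons_induction with
  | empty => simp
  | cons a s ha ih =>
    simp_rw [Finset.sym2_cons, Finset.sum_disjUnion, Finset.sum_map, Finset.sum_cons,
      Sym2.mkEmbedding_apply, Finset.sum_add_distrib, ih]
    simp_rw [Sym2.eq_swap (a := a)]
    module

/-- If `A v = 0` then the columns of the adjugate of `A` are proportional to `v`. -/
theorem mul_adjugate_eq {n R : Type*} [Fintype n] [DecidableEq n] [CommRing R]
    {A : Matrix n n R} {v : n → R} (h : A.mulVec v = 0) (i j k : n) :
    v i * A.adjugate j k = v j * A.adjugate i k := by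
  -- Cramer's rule: `C v` is `v j` times the `k`-th unit vector, `det C` is the adjugate entry `(j,
  -- k)` of `A`, and column `k` of the adjugate ignores row `k`.
  set C := A.updateRow k (Pi.single j 1) with hC
  have h1 : C.mulVec v = v j • Pi.single k 1 := by
    ext l
    by_cases hl : l = k
    · subst hl
      simp [hC, Matrix.mulVec]
    · have := congrFun h l
      simp only [Matrix.mulVec, Pi.zero_apply] at this
      simp [hC, Matrix.mulVec, hl, this]
  have h2 : C.adjugate.mulVec (C.mulVec v) = C.det • v := by
    rw [Matrix.mulVec_mulVec, Matrix.adjugate_mul, Matrix.smul_mulVec, Matrix.one_mulVec]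
  have h3 := congrFun h2 i
  rw [h1, Matrix.mulVec_smul, Matrix.mulVec_single_one] at h3
  simp only [Pi.smul_apply, smul_eq_mul, Matrix.col_apply] at h3
  have h4 : C.adjugate i k = A.adjugate i k := by
    rw [Matrix.adjugate_apply, Matrix.adjugate_apply, hC, Matrix.updateRow_idem]
  rw [h4] at h3
  rw [Matrix.adjugate_apply A j k, ← hC, h3, mul_comm]

variable {K : Type*} [CommRing K] {M₀ : Type*} [AddCommGroup M₀] [Module K M₀]
  (q₀ : QuadraticForm K M₀)

/-- The Gram matrix of a family of vectors. -/
def gram {ι : Type*} (u : ι → M₀) : Matrix ι ι K := Matrix.of fun i j => polar q₀ (u i) (u j)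

/-- The value of the half-determinant at a family of vectors. -/
noncomputable def semidiscValue {ν : ℕ} (u : Fin (2 * ν + 1) → M₀) : K :=
  MvPolynomial.aeval (gramValue q₀ u) (semidisc ν)

theorem map_genericMatrix {n : ℕ} (u : Fin n → M₀) :
    (MvPolynomial.aeval (gramValue q₀ u)).mapMatrix (genericMatrix n) = gram q₀ u := by
  ext i j
  by_cases h : i = j
  · subst h
    simp [genericMatrix, gram, gramValue, QuadraticMap.polar_self]
  · simp [genericMatrix, gram, gramValue, h]

theorem two_mul_semidiscValue {ν : ℕ} (u : Fin (2 * ν + 1) → M₀) :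
    2 * semidiscValue q₀ u = (gram q₀ u).det := by
  rw [← map_genericMatrix, ← AlgHom.map_det, ← two_mul_semidisc, map_mul, map_ofNat]
  rfl

theorem gram_transpose {ι : Type*} (u : ι → M₀) : (gram q₀ u).transpose = gram q₀ u := by
  ext i j
  exact QuadraticMap.polar_comm _ _ _

theorem genericMatrix_transpose (n : ℕ) : (genericMatrix n).transpose = genericMatrix n := by
  ext1 i j
  by_cases h : i = j
  · subst h; rfl
  · simp [genericMatrix, h, Ne.symm h, Sym2.eq_swap]

theorem adjugate_comm {n R : Type*} [Fintype n] [DecidableEq n] [CommRing R] {A : Matrix n n R}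
    (h : A.transpose = A) (i j : n) : A.adjugate i j = A.adjugate j i := by
  conv_lhs => rw [← h, ← Matrix.adjugate_transpose]
  rfl

/-- The entries of the adjugate of a symmetric matrix, indexed by unordered pairs. -/
def adjSym2 {n R : Type*} [Fintype n] [DecidableEq n] [CommRing R] {A : Matrix n n R}
    (h : A.transpose = A) : Sym2 n → R :=
  Sym2.lift ⟨A.adjugate, adjugate_comm h⟩

/-- The entries of a symmetric matrix, indexed by unordered pairs. -/
def entrySym2 {n R : Type*} {A : Matrix n n R} (h : A.transpose = A) : Sym2 n → R :=
  Sym2.lift ⟨A, fun i j => by conv_lhs => rw [← h, Matrix.transpose_apply]⟩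

/-- Euler's identity for `P_n`, homogeneous of degree `n`, whose partial derivatives are the
adjugate entries. Its double is the trace of `Ξ · adj Ξ = det Ξ · 1`, and `2` cancels over `ℤ`. The
subtracted sum corrects the diagonal entries `2 ξ_i` to `ξ_i`. -/
theorem semidisc_euler (ν : ℕ) : (2 * (ν : MvPolynomial _ ℤ) + 1) * semidisc ν =
    ∑ s ∈ (Finset.univ : Finset (Fin (2 * ν + 1))).sym2,
      entrySym2 (genericMatrix_transpose _) s * adjSym2 (genericMatrix_transpose _) s -
    ∑ i, MvPolynomial.X s(i, i) * (genericMatrix (2 * ν + 1)).adjugate i i := by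
  set G := genericMatrix (2 * ν + 1) with hG
  have h2 : (2 : MvPolynomial (Sym2 (Fin (2 * ν + 1))) ℤ) ≠ 0 := two_ne_zero
  refine mul_left_cancel₀ h2 ?_
  have hd : ∑ i, entrySym2 (genericMatrix_transpose (2 * ν + 1)) s(i, i) *
      adjSym2 (genericMatrix_transpose _) s(i, i) =
      2 * ∑ i, MvPolynomial.X s(i, i) * G.adjugate i i := by
    rw [Finset.mul_sum]
    refine Finset.sum_congr rfl fun i _ => ?_
    change G i i * G.adjugate i i = _
    rw [show G i i = 2 * MvPolynomial.X s(i, i) by simp [hG, genericMatrix], mul_assoc]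
  have ht := sum_sum_sym2 Finset.univ fun s => entrySym2 (genericMatrix_transpose (2 * ν + 1)) s *
      adjSym2 (genericMatrix_transpose _) s
  have htr : (G * G.adjugate).trace = (2 * ν + 1) * (2 * semidisc ν) := by
    rw [Matrix.mul_adjugate, Matrix.trace_smul, Matrix.trace_one, Fintype.card_fin, hG,
      ← two_mul_semidisc, smul_eq_mul]
    push_cast
    ring
  have htr' : (G * G.adjugate).trace = ∑ i, ∑ j,
      entrySym2 (genericMatrix_transpose (2 * ν + 1)) s(i, j) *
        adjSym2 (genericMatrix_transpose _) s(i, j) := by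
    refine Finset.sum_congr rfl fun i _ => ?_
    rw [Matrix.diag_apply, Matrix.mul_apply]
    refine Finset.sum_congr rfl fun j _ => ?_
    change G i j * G.adjugate j i = G i j * G.adjugate i j
    rw [adjugate_comm (genericMatrix_transpose _) i j]
  rw [mul_sub, ← hd, ← nsmul_eq_mul', ← smul_eq_mul (2 : MvPolynomial _ ℤ) (Finset.sum _ _)]
  simp only [nsmul_eq_mul, Nat.cast_ofNat, smul_eq_mul] at ht ⊢
  linear_combination htr' - htr + ht

theorem semidiscValue_euler {ν : ℕ} (u : Fin (2 * ν + 1) → M₀) :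
    (2 * (ν : K) + 1) * semidiscValue q₀ u =
    ∑ s ∈ (Finset.univ : Finset (Fin (2 * ν + 1))).sym2,
      polarSym2 q₀ (s.map u) * adjSym2 (gram_transpose q₀ u) s -
    ∑ i, q₀ (u i) * (gram q₀ u).adjugate i i := by
  have h := congrArg (MvPolynomial.aeval (gramValue q₀ u)) (semidisc_euler ν)
  have hG := map_genericMatrix q₀ u
  have hA : ∀ i j, MvPolynomial.aeval (gramValue q₀ u) ((genericMatrix _).adjugate i j) =
      (gram q₀ u).adjugate i j := fun i j => by
    rw [← hG, ← AlgHom.map_adjugate]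
    rfl
  rw [map_mul, map_add, map_mul, map_natCast, map_ofNat, map_one, map_sub, map_sum, map_sum] at h
  refine h.trans (congrArg₂ _ (Finset.sum_congr rfl fun s _ => ?_)
    (Finset.sum_congr rfl fun i _ => ?_))
  · induction s with | _ i j
    rw [map_mul]
    refine congrArg₂ _ ?_ (hA i j)
    exact congrFun (congrFun hG i) j
  · rw [map_mul, hA, MvPolynomial.aeval_X]
    simp [gramValue]

/-- The ideal of adjugate entries contains `n P_n` by Euler's identity and `2 P_n = det` by
expansion; `n` is odd. -/
theorem exists_semidiscValue_eq_sum_adjugate {ν : ℕ} (u : Fin (2 * ν + 1) → M₀) :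
    ∃ c : Fin (2 * ν + 1) × Fin (2 * ν + 1) → K,
      ∑ p, c p * (gram q₀ u).adjugate p.1 p.2 = semidiscValue q₀ u := by
  set J := Ideal.span (Set.range fun p : Fin (2 * ν + 1) × Fin (2 * ν + 1) =>
    (gram q₀ u).adjugate p.1 p.2) with hJ
  have hA : ∀ i j, (gram q₀ u).adjugate i j ∈ J := fun i j => Ideal.subset_span ⟨(i, j), rfl⟩
  have h1 : (2 * (ν : K) + 1) * semidiscValue q₀ u ∈ J := by
    rw [semidiscValue_euler]
    refine sub_mem (sum_mem fun s _ => Ideal.mul_mem_left _ _ ?_)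
      (sum_mem fun i _ => Ideal.mul_mem_left _ _ (hA i i))
    induction s with | _ i j
    exact hA i j
  have h2 : 2 * semidiscValue q₀ u ∈ J := by
    have h : ((gram q₀ u) * (gram q₀ u).adjugate) 0 0 = 2 * semidiscValue q₀ u := by
      rw [Matrix.mul_adjugate, two_mul_semidiscValue]
      simp
    rw [← h, Matrix.mul_apply]
    exact sum_mem fun i _ => Ideal.mul_mem_left _ _ (hA _ _)
  have h3 : semidiscValue q₀ u ∈ J := by
    have := sub_mem h1 (Ideal.mul_mem_left J (ν : K) h2)
    ring_nf at this
    exact this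
  rw [hJ, Ideal.span, Submodule.mem_span_range_iff_exists_fun] at h3
  simpa only [smul_eq_mul] using h3

theorem constantCoeff_semidisc (ν : ℕ) : MvPolynomial.constantCoeff (semidisc ν) = 0 := by
  have h := congrArg MvPolynomial.constantCoeff (two_mul_semidisc ν)
  rw [RingHom.map_det, map_mul, map_ofNat] at h
  have h0 : MvPolynomial.constantCoeff.mapMatrix (genericMatrix (2 * ν + 1)) = 0 := by
    ext i j
    by_cases h : i = j
    · subst h
      simp [genericMatrix]
    · simp [genericMatrix, h]
  rw [h0, Matrix.det_zero] at h
  omega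

theorem polar_mem_valueIdeal (x y : M₀) : polar q₀ x y ∈ valueIdeal q₀ := by
  have h : ∀ z, q₀ z ∈ valueIdeal q₀ := fun z => Ideal.subset_span ⟨z, rfl⟩
  exact sub_mem (sub_mem (h _) (h _)) (h _)

/-- Modulo the value ideal all variables specialize to zero, and `P_n` has no constant term. -/
theorem semidiscValue_mem_valueIdeal {ν : ℕ} (u : Fin (2 * ν + 1) → M₀) :
    semidiscValue q₀ u ∈ valueIdeal q₀ := by
  have hz : ∀ s, Ideal.Quotient.mkₐ ℤ (valueIdeal q₀) (gramValue q₀ u s) = 0 := by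
    intro s
    induction s with | _ i j
    refine Ideal.Quotient.eq_zero_iff_mem.mpr ?_
    by_cases h : i = j
    · subst h
      have hu : q₀ (u i) ∈ valueIdeal q₀ := Ideal.subset_span ⟨u i, rfl⟩
      simpa [gramValue] using hu
    · simpa [gramValue, h] using polar_mem_valueIdeal q₀ _ _
  rw [← Ideal.Quotient.eq_zero_iff_mem]
  change Ideal.Quotient.mkₐ ℤ (valueIdeal q₀) (MvPolynomial.aeval _ _) = 0
  rw [← AlgHom.comp_apply, MvPolynomial.comp_aeval]
  simp only [hz]
  rw [← Pi.zero_def, MvPolynomial.aeval_zero, constantCoeff_semidisc, map_zero]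

theorem valueIdeal_eq_top {ν : ℕ} (h : Semiregular ν q₀) : valueIdeal q₀ = ⊤ := by
  rw [eq_top_iff, ← h, Ideal.span_le]
  rintro _ ⟨u, rfl⟩
  exact semidiscValue_mem_valueIdeal q₀ u

theorem exists_semidiscValue_notMem {ν : ℕ} (h : Semiregular ν q₀) {m : Ideal K} (hm : m ≠ ⊤) :
    ∃ u : Fin (2 * ν + 1) → M₀, semidiscValue q₀ u ∉ m := by
  by_contra! hc
  refine hm (eq_top_iff.mpr ?_)
  rw [← h, Ideal.span_le]
  rintro _ ⟨u, rfl⟩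
  exact hc u

/-- A relation between vectors modulo an ideal annihilates the semidiscriminant. -/
theorem sq_mul_semidiscValue_mem {ν : ℕ} (u : Fin (2 * ν + 1) → M₀) (J : Ideal K)
    (a : Fin (2 * ν + 1) → K) (hq : q₀ (∑ i, a i • u i) ∈ J)
    (hb : ∀ x, polar q₀ x (∑ i, a i • u i) ∈ J) (j : Fin (2 * ν + 1)) :
    a j ^ 2 * semidiscValue q₀ u ∈ J := by
  set π := Ideal.Quotient.mk J
  set G := gram q₀ u with hG
  have hGa : (π.mapMatrix G).mulVec (fun i => π (a i)) = 0 := by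
    ext k
    have := Ideal.Quotient.eq_zero_iff_mem.mpr (hb (u k))
    rw [← QuadraticMap.polarBilin_apply_apply, map_sum (q₀.polarBilin (u k)), map_sum] at this
    rw [Pi.zero_apply, ← this, Matrix.mulVec, dotProduct]
    refine Finset.sum_congr rfl fun i _ => ?_
    rw [map_smul, smul_eq_mul, map_mul, mul_comm]
    rfl
  have hadj : ∀ i k, (π.mapMatrix G).adjugate i k = π (G.adjugate i k) := fun i k => by
    rw [← RingHom.map_adjugate]; rfl
  have h1 : ∀ i k l, π (a i * G.adjugate k l) = π (a k * G.adjugate i l) := fun i k l => by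
    rw [map_mul, map_mul, ← hadj, ← hadj]
    exact mul_adjugate_eq hGa i k l
  -- Proportionality applied to rows and then, by symmetry, to columns: the adjugate looks like a
  -- multiple of `a aᵀ`.
  have h2 : ∀ i k, π (a j ^ 2 * G.adjugate i k) = π (a i * a k * G.adjugate j j) := fun i k => by
    rw [pow_two, mul_assoc, map_mul, h1, ← map_mul, mul_left_comm,
      adjugate_comm (gram_transpose q₀ u), map_mul, h1, ← map_mul, mul_assoc]
  have h2π : π (2 * a j ^ 2 * semidiscValue q₀ u) = 0 := by
    have h := congrFun (congrArg (Matrix.mulVec · fun i => π (a i))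
      (Matrix.adjugate_mul (π.mapMatrix G))) j
    rw [← Matrix.mulVec_mulVec, hGa, Matrix.mulVec_zero, ← RingHom.map_det, hG,
      ← two_mul_semidiscValue, Matrix.smul_mulVec, Matrix.one_mulVec] at h
    rw [show 2 * a j ^ 2 * semidiscValue q₀ u = a j * (2 * semidiscValue q₀ u * a j) by ring,
      map_mul, map_mul π (2 * semidiscValue q₀ u)]
    simp only [Pi.zero_apply, Pi.smul_apply, smul_eq_mul] at h
    rw [← h, mul_zero]
  -- Substituting this in Euler's identity turns its right side into `adj_{jj} · q₀(∑ a_i u_i)`.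
  have h3 : π (a j ^ 2 * ((2 * (ν : K) + 1) * semidiscValue q₀ u)) = 0 := by
    have hqs : π (G.adjugate j j * q₀ (∑ i, a i • u i)) = 0 :=
      Ideal.Quotient.eq_zero_iff_mem.mpr (Ideal.mul_mem_left _ _ hq)
    rw [← hqs, semidiscValue_euler, QuadraticMap.map_sum', mul_sub, mul_sub, Finset.mul_sum,
      Finset.mul_sum, Finset.mul_sum, Finset.mul_sum, map_sub, map_sub, map_sum, map_sum, map_sum,
      map_sum]
    refine congrArg₂ _ (Finset.sum_congr rfl fun s _ => ?_) (Finset.sum_congr rfl fun i _ => ?_)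
    · induction s with | _ i k
      change π (a j ^ 2 * (polar q₀ (u i) (u k) * G.adjugate i k)) =
        π (G.adjugate j j * polar q₀ (a i • u i) (a k • u k))
      rw [mul_left_comm, map_mul, h2, ← map_mul, QuadraticMap.polar_smul_left,
        QuadraticMap.polar_smul_right, smul_eq_mul, smul_eq_mul]
      congr 1
      ring
    · rw [mul_left_comm, map_mul, h2, ← map_mul, QuadraticMap.map_smul, smul_eq_mul]
      congr 1
      ring
  rw [← Ideal.Quotient.eq_zero_iff_mem]
  change π _ = 0
  rw [show a j ^ 2 * semidiscValue q₀ u = a j ^ 2 * ((2 * (ν : K) + 1) * semidiscValue q₀ u) -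
    ν * (2 * a j ^ 2 * semidiscValue q₀ u) by ring, map_sub, h3, map_mul, h2π, mul_zero, sub_zero]

end Semidiscriminant

/-! ### Invariance of `N` under the orthogonal group -/

section Level

open QuadraticMap (polar)
open scoped TensorProduct

variable {K : Type*} [CommRing K] {M₀ : Type*} [AddCommGroup M₀] [Module K M₀]

theorem form_and_polar_mem_of_mem_smul_top (q₀ : QuadraticForm K M₀) {J : Ideal K} {y : M₀}
    (hy : y ∈ J • (⊤ : Submodule K M₀)) : q₀ y ∈ J ∧ ∀ x, polar q₀ x y ∈ J := by
  induction hy using Submodule.smul_induction_on' with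
  | smul r hr n _ =>
    refine ⟨?_, fun x => ?_⟩
    · rw [QuadraticMap.map_smul, smul_eq_mul, mul_assoc]
      exact J.mul_mem_right _ hr
    · rw [QuadraticMap.polar_smul_right, smul_eq_mul]
      exact J.mul_mem_right _ hr
  | add x _ y _ hx hy =>
    refine ⟨?_, fun z => ?_⟩
    · rw [QuadraticMap.map_add q₀]
      exact add_mem (add_mem hx.1 hy.1) (hy.2 x)
    · rw [QuadraticMap.polar_add_right]
      exact add_mem (hx.2 z) (hy.2 z)

/-- Embedding `M₀` as a direct summand of a free module, the coordinates of `y` vanish in the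
residue field and hence lie in `m`. -/
theorem mem_smul_top_of_one_tmul_eq_zero [Module.Projective K M₀] (m : Ideal K) [m.IsPrime] {y : M₀}
    (hy : (1 : m.ResidueField) ⊗ₜ[K] y = 0) : y ∈ m • (⊤ : Submodule K M₀) := by
  obtain ⟨s, hs⟩ := Module.projective_def.mp (inferInstance : Module.Projective K M₀)
  have h : ∀ x, s y x ∈ m := by
    intro x
    have := congrArg (TensorProduct.rid K m.ResidueField)
      (congrArg (LinearMap.lTensor m.ResidueField (Finsupp.lapply x ∘ₗ s)) hy)
    rw [LinearMap.lTensor_tmul, TensorProduct.rid_tmul, map_zero, map_zero, Algebra.smul_def,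
      mul_one, Ideal.algebraMap_residueField_eq_zero] at this
    exact this
  rw [← hs y, Finsupp.linearCombination_apply]
  exact sum_mem fun x _ => Submodule.smul_mem_smul (h x) trivial

/-- Over the residue field a relation between the `u_i` would force `P_n(u) ∈ m`, by
`sq_mul_semidiscValue_mem`. So they form a basis by the rank hypothesis, and Nakayama's lemma for
the quotient by their span provides `r ≡ 1` modulo `m`. -/
theorem exists_notMem_smul_mem_span [Module.Finite K M₀] [Module.Projective K M₀] {ν : ℕ}
    (hrank : ∀ p : PrimeSpectrum K, Module.rankAtStalk M₀ p = 2 * ν + 1)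
    (q₀ : QuadraticForm K M₀) (m : Ideal K) [m.IsMaximal] (u : Fin (2 * ν + 1) → M₀)
    (hu : semidiscValue q₀ u ∉ m) :
    ∃ r ∉ m, ∀ x : M₀, r • x ∈ Submodule.span K (Set.range u) := by
  set S := Submodule.span K (Set.range u) with hS
  set κ := m.ResidueField
  have hsurj : Function.Surjective (algebraMap K κ) := m.algebraMap_residueField_surjective
  have hsum : ∀ a : Fin (2 * ν + 1) → K, ∑ i, algebraMap K κ (a i) • ((1 : κ) ⊗ₜ[K] u i) =
      (1 : κ) ⊗ₜ[K] ∑ i, a i • u i := fun a => by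
    simp only [algebraMap_smul, TensorProduct.tmul_sum, TensorProduct.tmul_smul]
  have hli : LinearIndependent κ fun i => (1 : κ) ⊗ₜ[K] u i := by
    rw [Fintype.linearIndependent_iff]
    intro b hb j
    choose a ha using fun i => hsurj (b i)
    obtain rfl : (fun i => algebraMap K κ (a i)) = b := funext ha
    rw [hsum] at hb
    have hmem := form_and_polar_mem_of_mem_smul_top q₀ (mem_smul_top_of_one_tmul_eq_zero m hb)
    have := sq_mul_semidiscValue_mem q₀ u m a hmem.1 hmem.2 j
    rw [Ideal.algebraMap_residueField_eq_zero]
    exact (Ideal.IsPrime.mem_of_pow_mem inferInstance 2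
      ((Ideal.IsPrime.mem_or_mem inferInstance this).resolve_right hu))
  have hfin : Module.finrank κ (κ ⊗[K] M₀) = 2 * ν + 1 :=
    (Module.rankAtStalk_eq ⟨m, inferInstance⟩).symm.trans (hrank _)
  have hspan := hli.span_eq_top_of_card_eq_finrank (by rw [Fintype.card_fin, hfin])
  have hle : (⊤ : Submodule K M₀) ≤ S ⊔ m • ⊤ := by
    intro x _
    have hx : (1 : κ) ⊗ₜ[K] x ∈ Submodule.span κ (Set.range fun i => (1 : κ) ⊗ₜ[K] u i) := by
      rw [hspan]; trivial
    rw [Submodule.mem_span_range_iff_exists_fun] at hx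
    obtain ⟨b, hb⟩ := hx
    choose a ha using fun i => hsurj (b i)
    obtain rfl : (fun i => algebraMap K κ (a i)) = b := funext ha
    rw [hsum] at hb
    have h0 : (1 : κ) ⊗ₜ[K] (x - ∑ i, a i • u i) = 0 := by
      rw [TensorProduct.tmul_sub, hb, sub_self]
    rw [← add_sub_cancel (∑ i, a i • u i) x]
    exact Submodule.add_mem_sup
      (sum_mem fun i _ => Submodule.smul_mem _ _ (Submodule.subset_span ⟨i, rfl⟩))
      (mem_smul_top_of_one_tmul_eq_zero m h0)
  have hQ : (⊤ : Submodule K (M₀ ⧸ S)) ≤ m • ⊤ := by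
    rintro ⟨x⟩ -
    obtain ⟨s, hs, y, hy, hxy⟩ := Submodule.mem_sup.mp (hle (Submodule.mem_top (x := x)))
    have h1 : S.mkQ y ∈ (m • (⊤ : Submodule K M₀)).map S.mkQ := Submodule.mem_map_of_mem hy
    rw [Submodule.map_smul'', Submodule.map_top, Submodule.range_mkQ] at h1
    have h2 : S.mkQ x = S.mkQ y := by
      rw [← hxy, map_add, (Submodule.Quotient.mk_eq_zero S).mpr hs |> fun h => (h : S.mkQ s = 0),
        zero_add]
    change S.mkQ x ∈ _
    rwa [h2]
  obtain ⟨r, hr, hr'⟩ := Submodule.exists_sub_one_mem_and_smul_eq_zero_of_fg_of_le_smul m ⊤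
    Module.Finite.fg_top hQ
  refine ⟨r, fun h => ?_, fun x => ?_⟩
  · refine (inferInstance : m.IsMaximal).ne_top ((Ideal.eq_top_iff_one m).mpr ?_)
    simpa using sub_mem h hr
  · rw [← Submodule.Quotient.mk_eq_zero S, Submodule.Quotient.mk_smul]
    exact hr' _ trivial

/-- An endomorphism maps a vector of the radical modulo `I` into `N₀` if the image lies in the
radical, up to a factor that is invertible where the Gram determinant is. -/
theorem smul_mem_of_polar_mem (q₀ : QuadraticForm K M₀) {N₀ : Submodule K M₀} {I : Ideal K}
    (hI : I • (⊤ : Submodule K M₀) ≤ N₀) {ν : ℕ} (u : Fin (2 * ν + 1) → M₀) {r : K}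
    (hr : ∀ x : M₀, r • x ∈ Submodule.span K (Set.range u)) (h : M₀ →ₗ[K] M₀) {n : M₀}
    (hn : n ∈ N₀) (hbn : ∀ x, polar q₀ x n ∈ I) (hbh : ∀ x, polar q₀ x (h n) ∈ I) :
    (semidiscValue q₀ u * r ^ 2) • h n ∈ N₀ := by
  simp only [Submodule.mem_span_range_iff_exists_fun] at hr
  obtain ⟨v, hv⟩ := hr n
  choose g hg using fun l => hr (h (u l))
  set w : Fin (2 * ν + 1) → K := fun j => ∑ l, g l j * v l with hw
  have hwu : ∑ j, w j • u j = r ^ 2 • h n := by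
    have : ∑ j, w j • u j = ∑ l, v l • ∑ j, g l j • u j := by
      simp only [hw, Finset.sum_smul, Finset.smul_sum, smul_smul]
      rw [Finset.sum_comm]
      simp only [mul_comm]
    rw [this]
    simp only [hg]
    rw [pow_two, mul_smul, ← map_smul h, ← hv, map_sum, Finset.smul_sum]
    simp only [map_smul, smul_comm r]
  set π := Ideal.Quotient.mk I
  set G := gram q₀ u
  have hG : ∀ (a : Fin (2 * ν + 1) → K) (c : K) (y : M₀), ∑ i, a i • u i = c • y →
      (∀ x, polar q₀ x y ∈ I) → (π.mapMatrix G).mulVec (fun i => π (a i)) = 0 := by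
    intro a c y hay hy
    ext k
    have h1 : polar q₀ (u k) (∑ i, a i • u i) ∈ I := by
      rw [hay, QuadraticMap.polar_smul_right]
      exact I.mul_mem_left _ (hy _)
    have := Ideal.Quotient.eq_zero_iff_mem.mpr h1
    rw [← QuadraticMap.polarBilin_apply_apply, map_sum (q₀.polarBilin (u k)), map_sum] at this
    rw [Pi.zero_apply, ← this, Matrix.mulVec, dotProduct]
    refine Finset.sum_congr rfl fun i _ => ?_
    rw [map_smul, smul_eq_mul, map_mul, mul_comm]
    rfl
  have hadj : ∀ (a : Fin (2 * ν + 1) → K), (π.mapMatrix G).mulVec (fun i => π (a i)) = 0 →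
      ∀ i k l, π (a i) * π (G.adjugate k l) = π (a k) * π (G.adjugate i l) := by
    intro a ha i k l
    have := mul_adjugate_eq ha i k l
    rwa [← RingHom.map_adjugate] at this
  have hv' := hadj v (hG v r n hv hbn)
  have hw' := hadj w (hG w (r ^ 2) (h n) hwu hbh)
  obtain ⟨c, hc⟩ := exists_semidiscValue_eq_sum_adjugate q₀ u
  -- The scalar by which `P_n(u) r h` acts on `r n` modulo `I`. Expand `P_n(u)` in adjugate entries,
  -- use proportionality to `w` to bring in `w_{p.1} = ∑ g_{l, p.1} v_l`, then proportionality to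
  -- `v` to take out `v_i`.
  set t : K := ∑ p, c p * ∑ l, g l p.1 * G.adjugate l p.2 with ht
  have key : ∀ i, semidiscValue q₀ u * w i - t * v i ∈ I := by
    intro i
    rw [← Ideal.Quotient.eq, ← hc, ht]
    simp only [map_mul, map_sum, Finset.sum_mul]
    refine Finset.sum_congr rfl fun p _ => ?_
    rw [mul_assoc, mul_assoc, mul_comm (π (G.adjugate _ _)), hw', Finset.sum_mul]
    simp only [hw, map_sum, map_mul, Finset.sum_mul]
    congr 1
    refine Finset.sum_congr rfl fun l _ => ?_
    rw [mul_assoc, mul_assoc, mul_comm (π (G.adjugate _ _)) (π (v i)), hv' i l]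
  rw [mul_smul, ← hwu, Finset.smul_sum]
  have hsum : ∑ i, semidiscValue q₀ u • w i • u i =
      ∑ i, (semidiscValue q₀ u * w i - t * v i) • u i + t • r • n := by
    rw [← hv, Finset.smul_sum, ← Finset.sum_add_distrib]
    refine Finset.sum_congr rfl fun i _ => ?_
    module
  rw [hsum]
  exact add_mem (sum_mem fun i _ => hI (Submodule.smul_mem_smul (key i) trivial))
    (N₀.smul_mem _ (N₀.smul_mem _ hn))

theorem mem_level {N₀ : Submodule K M₀} {I : Ideal K} {v : Mod K M₀} :
    v ∈ level N₀ I ↔ (∀ i, v.1 i ∈ I) ∧ v.2 ∈ N₀ := by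
  simp [level, Submodule.mem_prod, Submodule.mem_pi]

theorem smul_mem_level {N₀ : Submodule K M₀} {I : Ideal K} (hI : I • (⊤ : Submodule K M₀) ≤ N₀)
    {a : K} (ha : a ∈ I) (v : Mod K M₀) : a • v ∈ level N₀ I :=
  mem_level.mpr ⟨fun _ => I.mul_mem_right _ ha, hI (Submodule.smul_mem_smul ha trivial)⟩

/-- The orthogonal group of a semiregular form preserves the submodule `N`. -/
theorem apply_mem_level [Module.Finite K M₀] [Module.Projective K M₀] {ν : ℕ}
    (hrank : ∀ p : PrimeSpectrum K, Module.rankAtStalk M₀ p = 2 * ν + 1)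
    {q₀ : QuadraticForm K M₀} (hq₀ : Semiregular ν q₀) {N₀ : Submodule K M₀} {I : Ideal K}
    (hNI : Admissible q₀ N₀ I) (g : orth q₀) {v : Mod K M₀} (hv : v ∈ level N₀ I) :
    g.1 v ∈ level N₀ I := by
  rw [mem_level] at hv
  have hpol : ∀ (n : M₀), n ∈ N₀ → ∀ x, polar (form q₀) x (g.1 (0, n)) ∈ I := by
    intro n hn x
    rw [← g.1.apply_symm_apply x, ← LinearEquiv.coe_toLinearMap,
      polar_apply_apply (form q₀) (g := g.1.toLinearMap) g.2, QuadraticMap.polar_comm, polar_inr,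
      QuadraticMap.polar_comm]
    exact hNI.polar_mem _ n hn
  have hinr : ∀ n ∈ N₀, g.1 (0, n) ∈ level N₀ I := by
    intro n hn
    rw [mem_level]
    refine ⟨fun i => ?_, ?_⟩
    · have := hpol n hn (hyp K M₀ (-i))
      rwa [polar_hyp, Idx.neg_neg] at this
    · set h : M₀ →ₗ[K] M₀ := LinearMap.snd K _ _ ∘ₗ g.1.toLinearMap ∘ₗ LinearMap.inr K _ _
      change h n ∈ N₀
      by_contra hc
      -- The scalars taking `h n` into `N₀`. If `J` were proper, a maximal ideal above it would
      -- contain `P_n(u) r²`, although neither factor lies in it.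
      set J : Ideal K := N₀.comap (LinearMap.toSpanSingleton K M₀ (h n))
      have hJ : J ≠ ⊤ := fun hJ => hc (by
        have : (1 : K) ∈ J := by rw [hJ]; trivial
        simpa [J] using this)
      obtain ⟨m, hm, hJm⟩ := Ideal.exists_le_maximal J hJ
      obtain ⟨u, hu⟩ := exists_semidiscValue_notMem q₀ hq₀ hm.ne_top
      obtain ⟨r, hr, hru⟩ := exists_notMem_smul_mem_span hrank q₀ m u hu
      have hmem : semidiscValue q₀ u * r ^ 2 ∈ J :=
        smul_mem_of_polar_mem q₀ hNI.smul_le u hru h hn (fun x => hNI.polar_mem x n hn)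
          (fun x => by
            have := hpol n hn (0, x)
            rwa [polar_inr] at this)
      rcases hm.isPrime.mem_or_mem (hJm hmem) with h | h
      · exact hu h
      · exact hr (hm.isPrime.mem_of_pow_mem 2 h)
  obtain ⟨j, hj⟩ := Idx.pos1.exists_indep
  rw [hyp_decomp hj v]
  simp only [map_add, map_smul]
  have hs : ∀ i k, v.1 i • g.1 (hyp K M₀ k) ∈ level N₀ I := fun i k =>
    smul_mem_level hNI.smul_le (hv.1 i) _
  exact add_mem (add_mem (add_mem (hs _ _) (hs _ _)) (hinr _ hv.2)) (add_mem (hs _ _) (hs _ _))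

end Level

/-! ### The double along `(N₀, I)` and the relative groups -/

section Double

open QuadraticMap (polar)

variable {K : Type*} [CommRing K] {M₀ : Type*} [AddCommGroup M₀] [Module K M₀]
  {q₀ : QuadraticForm K M₀} {N₀ : Submodule K M₀} {I : Ideal K}

/-- The double `K ×_{K/I} K` of the ring `K` along the ideal `I`. -/
def doubleRing (I : Ideal K) : Subring (K × K) where
  carrier := {a | a.1 - a.2 ∈ I}
  mul_mem' := fun {a b} ha hb => by
    have := add_mem (I.mul_mem_right b.1 ha) (I.mul_mem_left a.2 hb)
    change a.1 * b.1 - a.2 * b.2 ∈ I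
    convert this using 1
    ring
  one_mem' := by simp
  add_mem' := fun {a b} ha hb => by
    have := I.add_mem ha hb
    change a.1 + b.1 - (a.2 + b.2) ∈ I
    convert this using 1
    ring
  zero_mem' := by simp
  neg_mem' := fun {a} ha => by
    have := I.neg_mem ha
    change -a.1 - -a.2 ∈ I
    convert this using 1
    ring

/-- The double `M₀ ×_{M₀/N₀} M₀` of the module `M₀` along the submodule `N₀`. -/
def doubleMod (_ : Admissible q₀ N₀ I) : AddSubgroup (M₀ × M₀) where
  carrier := {u | u.1 - u.2 ∈ N₀}
  add_mem' := fun {a b} ha hb => by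
    have := N₀.add_mem ha hb
    change a.1 + b.1 - (a.2 + b.2) ∈ N₀
    convert this using 1
    abel
  zero_mem' := by simp
  neg_mem' := fun {a} ha => by
    have := N₀.neg_mem ha
    change -a.1 - -a.2 ∈ N₀
    convert this using 1
    abel

variable (hNI : Admissible q₀ N₀ I)

instance : Module (doubleRing I) (doubleMod hNI) where
  smul a u := ⟨(a.1.1 • u.1.1, a.1.2 • u.1.2), by
    have h1 : a.1.1 • (u.1.1 - u.1.2) ∈ N₀ := N₀.smul_mem _ u.2
    have h2 : (a.1.1 - a.1.2) • u.1.2 ∈ N₀ :=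
      hNI.smul_le (Submodule.smul_mem_smul a.2 trivial)
    have := add_mem h1 h2
    change a.1.1 • u.1.1 - a.1.2 • u.1.2 ∈ N₀
    convert this using 1
    module⟩
  one_smul u := Subtype.ext (Prod.ext (one_smul _ _) (one_smul _ _))
  mul_smul a b u := Subtype.ext (Prod.ext (mul_smul _ _ _) (mul_smul _ _ _))
  smul_zero a := Subtype.ext (Prod.ext (smul_zero _) (smul_zero _))
  smul_add a u w := Subtype.ext (Prod.ext (smul_add _ _ _) (smul_add _ _ _))
  add_smul a b u := Subtype.ext (Prod.ext (add_smul _ _ _) (add_smul _ _ _))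
  zero_smul u := Subtype.ext (Prod.ext (zero_smul _ _) (zero_smul _ _))

theorem smul_doubleMod_fst (a : doubleRing I) (u : doubleMod hNI) :
    (a • u).1.1 = a.1.1 • u.1.1 := rfl

theorem smul_doubleMod_snd (a : doubleRing I) (u : doubleMod hNI) :
    (a • u).1.2 = a.1.2 • u.1.2 := rfl

/-- The double of the quadratic form `q₀`. -/
def doubleForm : QuadraticForm (doubleRing I) (doubleMod hNI) :=
  QuadraticMap.ofPolar
    (fun u => ⟨(q₀ u.1.1, q₀ u.1.2), by
      have h : q₀ u.1.1 = q₀ u.1.2 + q₀ (u.1.1 - u.1.2) + polar q₀ u.1.2 (u.1.1 - u.1.2) := by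
        rw [← QuadraticMap.map_add q₀, add_sub_cancel]
      have := add_mem (hNI.form_mem _ u.2) (hNI.polar_mem u.1.2 _ u.2)
      change q₀ u.1.1 - q₀ u.1.2 ∈ I
      rw [h]
      convert this using 1
      ring⟩)
    (fun a u => Subtype.ext (Prod.ext (q₀.map_smul _ _) (q₀.map_smul _ _)))
    (fun u u' w => Subtype.ext (Prod.ext (QuadraticMap.polar_add_left q₀ u.1.1 u'.1.1 w.1.1)
      (QuadraticMap.polar_add_left q₀ u.1.2 u'.1.2 w.1.2)))
    (fun a u w => Subtype.ext (Prod.ext (QuadraticMap.polar_smul_left q₀ a.1.1 u.1.1 w.1.1)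
      (QuadraticMap.polar_smul_left q₀ a.1.2 u.1.2 w.1.2)))

/-- The diagonal embedding carries a representation of `1` by values of `q₀` to the double. -/
theorem valueIdeal_doubleForm (h : valueIdeal q₀ = ⊤) : valueIdeal (doubleForm hNI) = ⊤ := by
  let δ : K →+* doubleRing I :=
    ((RingHom.id K).prod (RingHom.id K)).codRestrict (doubleRing I) fun a => by
      change a - a ∈ I
      simp
  have hle : valueIdeal q₀ ≤ (valueIdeal (doubleForm hNI)).comap δ := by
    rw [valueIdeal, Ideal.span_le]
    rintro _ ⟨m, rfl⟩
    exact Ideal.subset_span ⟨⟨(m, m), by change m - m ∈ N₀; simp⟩, rfl⟩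
  rw [h] at hle
  rw [Ideal.eq_top_iff_one, ← map_one δ]
  exact hle (Submodule.mem_top (x := (1 : K)))

/-- The first projection of the double of `M`. -/
def pr₁ (v : Mod (doubleRing I) (doubleMod hNI)) : Mod K M₀ := (fun i => (v.1 i).1.1, v.2.1.1)

/-- The second projection of the double of `M`. -/
def pr₂ (v : Mod (doubleRing I) (doubleMod hNI)) : Mod K M₀ := (fun i => (v.1 i).1.2, v.2.1.2)

theorem pr₁_sub_pr₂_mem (v : Mod (doubleRing I) (doubleMod hNI)) :
    pr₁ hNI v - pr₂ hNI v ∈ level N₀ I :=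
  mem_level.mpr ⟨fun i => (v.1 i).2, v.2.2⟩

/-- The element of the double of `M` given by a congruent pair. -/
def doubleMk (v w : Mod K M₀) (h : v - w ∈ level N₀ I) :
    Mod (doubleRing I) (doubleMod hNI) :=
  (fun i => ⟨(v.1 i, w.1 i), (mem_level.mp h).1 i⟩, ⟨(v.2, w.2), (mem_level.mp h).2⟩)

theorem double_ext {v w : Mod (doubleRing I) (doubleMod hNI)} (h₁ : pr₁ hNI v = pr₁ hNI w)
    (h₂ : pr₂ hNI v = pr₂ hNI w) : v = w :=
  Prod.ext (funext fun i => Subtype.ext (Prod.ext (congrFun (congrArg Prod.fst h₁) i)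
    (congrFun (congrArg Prod.fst h₂) i)))
    (Subtype.ext (Prod.ext (congrArg (fun x : Mod K M₀ => x.2) h₁)
      (congrArg (fun x : Mod K M₀ => x.2) h₂)))

theorem form_double (v : Mod (doubleRing I) (doubleMod hNI)) :
    (form (doubleForm hNI) v).1 = (form q₀ (pr₁ hNI v), form q₀ (pr₂ hNI v)) := rfl

/-- The linear endomorphism of the double of `M` induced by a congruent pair. -/
def doubleMap (a b : Mod K M₀ →ₗ[K] Mod K M₀)
    (h : ∀ v w, v - w ∈ level N₀ I → a v - b w ∈ level N₀ I) :
    Mod (doubleRing I) (doubleMod hNI) →ₗ[doubleRing I] Mod (doubleRing I) (doubleMod hNI) where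
  toFun v := doubleMk hNI (a (pr₁ hNI v)) (b (pr₂ hNI v)) (h _ _ (pr₁_sub_pr₂_mem hNI v))
  map_add' v w := double_ext hNI (map_add a (pr₁ hNI v) (pr₁ hNI w))
    (map_add b (pr₂ hNI v) (pr₂ hNI w))
  map_smul' c v := double_ext hNI (map_smul a c.1.1 (pr₁ hNI v)) (map_smul b c.1.2 (pr₂ hNI v))

/-- The isometry `φ` of the double of `M` induces `a` and `b` on the two factors. -/
def Lifts (φ : orth (doubleForm hNI)) (a b : orth q₀) : Prop :=
  ∀ v, pr₁ hNI (φ.1 v) = a.1 (pr₁ hNI v) ∧ pr₂ hNI (φ.1 v) = b.1 (pr₂ hNI v)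

theorem exists_lifts (a b : orth q₀)
    (h : ∀ v w, v - w ∈ level N₀ I → a.1 v - b.1 w ∈ level N₀ I)
    (h' : ∀ v w, v - w ∈ level N₀ I → a.1⁻¹ v - b.1⁻¹ w ∈ level N₀ I) :
    ∃ φ : orth (doubleForm hNI), Lifts hNI φ a b := by
  refine ⟨⟨LinearEquiv.ofLinearMap
    (doubleMap hNI a.1.toLinearMap b.1.toLinearMap h)
    (doubleMap hNI a.1⁻¹.toLinearMap b.1⁻¹.toLinearMap h') ?_ ?_, ?_⟩, ?_⟩
  · exact LinearMap.ext fun v => double_ext hNI (a.1.apply_symm_apply _) (b.1.apply_symm_apply _)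
  · exact LinearMap.ext fun v => double_ext hNI (a.1.symm_apply_apply _) (b.1.symm_apply_apply _)
  · intro v
    refine Subtype.ext ?_
    rw [form_double, form_double]
    exact Prod.ext (a.2 _) (b.2 _)
  · exact fun v => ⟨rfl, rfl⟩

variable {hNI}

theorem Lifts.mul {φ ψ : orth (doubleForm hNI)} {a b c d : orth q₀} (h : Lifts hNI φ a b)
    (h' : Lifts hNI ψ c d) : Lifts hNI (φ * ψ) (a * c) (b * d) := fun v => by
  constructor
  · change pr₁ hNI (φ.1 (ψ.1 v)) = a.1 (c.1 _)
    rw [(h _).1, (h' _).1]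
  · change pr₂ hNI (φ.1 (ψ.1 v)) = b.1 (d.1 _)
    rw [(h _).2, (h' _).2]

theorem Lifts.inv {φ : orth (doubleForm hNI)} {a b : orth q₀} (h : Lifts hNI φ a b) :
    Lifts hNI φ⁻¹ a⁻¹ b⁻¹ := fun v => by
  have h1 : φ.1 (φ⁻¹.1 v) = v := φ.1.apply_symm_apply v
  have h2 := h (φ⁻¹.1 v)
  rw [h1] at h2
  exact ⟨(a.1.symm_apply_eq.mpr h2.1).symm, (b.1.symm_apply_eq.mpr h2.2).symm⟩

theorem Lifts.unique {φ : orth (doubleForm hNI)} {a b c d : orth q₀} (h : Lifts hNI φ a b)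
    (h' : Lifts hNI φ c d) : a = c ∧ b = d := by
  have key : ∀ v : Mod K M₀, a.1 v = c.1 v ∧ b.1 v = d.1 v := fun v => by
    have hv : v - v ∈ level N₀ I := by rw [sub_self]; exact zero_mem _
    have h1 := h (doubleMk hNI v v hv)
    have h2 := h' (doubleMk hNI v v hv)
    exact ⟨h1.1.symm.trans h2.1, h1.2.symm.trans h2.2⟩
  exact ⟨Subtype.ext (LinearEquiv.ext fun v => (key v).1),
    Subtype.ext (LinearEquiv.ext fun v => (key v).2)⟩

variable (hNI)

theorem lifts_T₂ (i j : Idx) (h₁ : i ≠ j) (h₂ : i ≠ -j) (y : doubleRing I) :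
    Lifts hNI (T₂ (doubleForm hNI) i j h₁ h₂ y) (T₂ q₀ i j h₁ h₂ y.1.1)
      (T₂ q₀ i j h₁ h₂ y.1.2) := by
  intro v
  change pr₁ hNI (rootMap _ i j y v) = rootMap M₀ i j y.1.1 (pr₁ hNI v) ∧
    pr₂ hNI (rootMap _ i j y v) = rootMap M₀ i j y.1.2 (pr₂ hNI v)
  constructor <;>
  · refine Prod.ext (funext fun k => ?_) ?_
    · simp only [pr₁, pr₂, rootMap, LinearMap.coe_mk, AddHom.coe_mk, Prod.fst_add, Prod.fst_sub,
        Pi.add_apply, Pi.sub_apply, Pi.single_apply]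
      split_ifs <;> simp
    · simp [pr₁, pr₂, rootMap]

theorem polar_doubleForm (u w : doubleMod hNI) : (polar (doubleForm hNI) u w).1 =
    (polar q₀ u.1.1 w.1.1, polar q₀ u.1.2 w.1.2) := rfl

theorem doubleForm_apply (u : doubleMod hNI) : (doubleForm hNI u).1 =
    (q₀ u.1.1, q₀ u.1.2) := rfl

theorem lifts_T₁ (i : Idx) (u : doubleMod hNI) :
    Lifts hNI (T₁ (doubleForm hNI) i u) (T₁ q₀ i u.1.1) (T₁ q₀ i u.1.2) := by
  intro v
  change pr₁ hNI (shortMap _ i u v) = shortMap q₀ i u.1.1 (pr₁ hNI v) ∧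
    pr₂ hNI (shortMap _ i u v) = shortMap q₀ i u.1.2 (pr₂ hNI v)
  constructor <;>
  · refine Prod.ext (funext fun k => ?_) ?_
    · simp only [pr₁, pr₂, shortMap, LinearMap.coe_mk, AddHom.coe_mk, Prod.fst_add, Prod.fst_sub,
        Pi.add_apply, Pi.sub_apply, Pi.single_apply]
      split_ifs <;> simp [polar_doubleForm, doubleForm_apply]
    · simp [pr₁, pr₂, shortMap, smul_doubleMod_fst, smul_doubleMod_snd]

variable {hNI}

theorem T₂_mul_T₂ (i j : Idx) (h₁ : i ≠ j) (h₂ : i ≠ -j) (y z : K) :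
    T₂ q₀ i j h₁ h₂ y * T₂ q₀ i j h₁ h₂ z = T₂ q₀ i j h₁ h₂ (y + z) := by
  refine Subtype.ext (LinearEquiv.toLinearMap_injective ?_)
  have h : polar (form q₀) (hyp K M₀ (-j)) (hyp K M₀ i) = 0 :=
    polar_hyp_hyp q₀ (Idx.Indep.neg_left (Idx.Indep.symm ⟨h₁, h₂⟩))
  rw [T₂_coe, add_smul, ← esd_comp_esd (form q₀) (form_hyp q₀ _)
    (by rw [QuadraticMap.polar_smul_right, h, smul_zero])
    (by rw [QuadraticMap.polar_smul_right, h, smul_zero]), ← T₂_coe i j h₁ h₂, ← T₂_coe i j h₁ h₂]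
  rfl

theorem T₁_mul_T₁ (i : Idx) (u w : M₀) : T₁ q₀ i u * T₁ q₀ i w = T₁ q₀ i (u + w) := by
  refine Subtype.ext (LinearEquiv.toLinearMap_injective ?_)
  have h := esd_comp_esd (form q₀) (form_hyp q₀ (-i)) (polar_hyp_inr q₀ (-i) u)
    (polar_hyp_inr q₀ (-i) w)
  rw [Prod.mk_add_mk, add_zero, ← T₁_coe, ← T₁_coe, ← T₁_coe] at h
  exact h

theorem transvections_subset_relElem : transvections q₀ N₀ I ⊆ relElem q₀ N₀ I := fun t ht =>
  Subgroup.subset_closure ⟨1, one_mem _, t, ht, by rw [one_mul, inv_one, mul_one]⟩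

theorem conj_mem_relElem_of_mem_elem {g x : orth q₀} (hg : g ∈ elem q₀)
    (hx : x ∈ relElem q₀ N₀ I) : g * x * g⁻¹ ∈ relElem q₀ N₀ I := by
  induction hx using Subgroup.closure_induction with
  | mem x hx =>
    obtain ⟨h, hh, t, ht, rfl⟩ := hx
    exact Subgroup.subset_closure ⟨g * h, mul_mem hg hh, t, ht, by group⟩
  | one => rw [mul_one, mul_inv_cancel]; exact one_mem _
  | mul x y _ _ hx hy =>
    have := mul_mem hx hy
    rwa [show g * x * g⁻¹ * (g * y * g⁻¹) = g * (x * y) * g⁻¹ by group] at this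
  | inv x _ hx =>
    have := inv_mem hx
    rwa [show (g * x * g⁻¹)⁻¹ = g * x⁻¹ * g⁻¹ by group] at this

/-- On generators the two components differ by a transvection with parameter in `I` or `N₀`.
Products and inverses need only that `EO(M, q)` normalizes `EO(M, q, N₀, I)`, which is built into
its definition. -/
theorem exists_lifts_of_mem_elem_double {φ : orth (doubleForm hNI)}
    (hφ : φ ∈ elem (doubleForm hNI)) :
    ∃ a ∈ elem q₀, ∃ b, a⁻¹ * b ∈ relElem q₀ N₀ I ∧ Lifts hNI φ a b := by
  induction hφ using Subgroup.closure_induction with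
  | mem φ hφ =>
    rcases hφ with ⟨i, j, h₁, h₂, y, -, rfl⟩ | ⟨i, u, -, rfl⟩
    · refine ⟨_, Subgroup.subset_closure (Or.inl ⟨i, j, h₁, h₂, y.1.1, trivial, rfl⟩), _, ?_,
        lifts_T₂ hNI i j h₁ h₂ y⟩
      have h : T₂ q₀ i j h₁ h₂ y.1.2 =
          T₂ q₀ i j h₁ h₂ y.1.1 * T₂ q₀ i j h₁ h₂ (-(y.1.1 - y.1.2)) := by
        rw [T₂_mul_T₂]
        congr 1
        ring
      rw [h, inv_mul_cancel_left]
      exact transvections_subset_relElem (Or.inl ⟨i, j, h₁, h₂, _, neg_mem y.2, rfl⟩)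
    · refine ⟨_, Subgroup.subset_closure (Or.inr ⟨i, u.1.1, trivial, rfl⟩), _, ?_,
        lifts_T₁ hNI i u⟩
      have h : T₁ q₀ i u.1.2 = T₁ q₀ i u.1.1 * T₁ q₀ i (-(u.1.1 - u.1.2)) := by
        rw [T₁_mul_T₁]
        congr 1
        abel
      rw [h, inv_mul_cancel_left]
      exact transvections_subset_relElem (Or.inr ⟨i, _, neg_mem u.2, rfl⟩)
  | one => exact ⟨1, one_mem _, 1, by rw [mul_one, inv_one]; exact one_mem _, fun v => ⟨rfl, rfl⟩⟩
  | mul φ ψ _ _ hφ hψ =>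
    obtain ⟨a, ha, b, hab, h⟩ := hφ
    obtain ⟨c, hc, d, hcd, h'⟩ := hψ
    refine ⟨a * c, mul_mem ha hc, b * d, ?_, h.mul h'⟩
    have := mul_mem (conj_mem_relElem_of_mem_elem (inv_mem hc) hab) hcd
    rwa [show c⁻¹ * (a⁻¹ * b) * c⁻¹⁻¹ * (c⁻¹ * d) = (a * c)⁻¹ * (b * d) by group] at this
  | inv φ _ hφ =>
    obtain ⟨a, ha, b, hab, h⟩ := hφ
    refine ⟨a⁻¹, inv_mem ha, b⁻¹, ?_, h.inv⟩
    have := conj_mem_relElem_of_mem_elem ha (inv_mem hab)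
    rwa [show a * (a⁻¹ * b)⁻¹ * a⁻¹ = a⁻¹⁻¹ * b⁻¹ by group] at this

theorem mem_relElem_of_lifts {φ : orth (doubleForm hNI)} (hφ : φ ∈ elem (doubleForm hNI))
    {z : orth q₀} (h : Lifts hNI φ 1 z) : z ∈ relElem q₀ N₀ I := by
  obtain ⟨a, -, b, hab, h'⟩ := exists_lifts_of_mem_elem_double hφ
  obtain ⟨rfl, rfl⟩ := h.unique h'
  rwa [inv_one, one_mul] at hab

theorem exists_mem_elem_double_lifts (hNI : Admissible q₀ N₀ I) {t : orth q₀} (ht : t ∈ elem q₀) :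
    ∃ φ ∈ elem (doubleForm hNI), Lifts hNI φ t t := by
  induction ht using Subgroup.closure_induction with
  | mem t ht =>
    rcases ht with ⟨i, j, h₁, h₂, y, -, rfl⟩ | ⟨i, u, -, rfl⟩
    · exact ⟨_, Subgroup.subset_closure (Or.inl ⟨i, j, h₁, h₂, _, trivial, rfl⟩),
        lifts_T₂ hNI i j h₁ h₂ ⟨(y, y), by change y - y ∈ I; simp⟩⟩
    · exact ⟨_, Subgroup.subset_closure (Or.inr ⟨i, _, trivial, rfl⟩),
        lifts_T₁ hNI i ⟨(u, u), by change u - u ∈ N₀; simp⟩⟩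
  | one => exact ⟨1, one_mem _, fun v => ⟨rfl, rfl⟩⟩
  | mul s t _ _ hs ht =>
    obtain ⟨φ, hφ, h⟩ := hs
    obtain ⟨ψ, hψ, h'⟩ := ht
    exact ⟨φ * ψ, mul_mem hφ hψ, h.mul h'⟩
  | inv t _ ht =>
    obtain ⟨φ, hφ, h⟩ := ht
    exact ⟨φ⁻¹, inv_mem hφ, h.inv⟩

theorem T₂_zero (i j : Idx) (h₁ : i ≠ j) (h₂ : i ≠ -j) : T₂ q₀ i j h₁ h₂ 0 = 1 := by
  have := T₂_mul_T₂ (q₀ := q₀) i j h₁ h₂ 0 0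
  rwa [add_zero, mul_eq_left] at this

theorem T₁_zero (i : Idx) : T₁ q₀ i 0 = 1 := by
  have := T₁_mul_T₁ (q₀ := q₀) i 0 0
  rwa [add_zero, mul_eq_left] at this

theorem exists_mem_elem_double_lifts_one (hNI : Admissible q₀ N₀ I) {t : orth q₀} (ht : t ∈ transvections q₀ N₀ I) :
    ∃ φ ∈ elem (doubleForm hNI), Lifts hNI φ 1 t := by
  rcases ht with ⟨i, j, h₁, h₂, y, hy, rfl⟩ | ⟨i, u, hu, rfl⟩
  · have := lifts_T₂ hNI i j h₁ h₂ ⟨(0, y), by change 0 - y ∈ I; simpa using hy⟩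
    rw [T₂_zero] at this
    exact ⟨_, Subgroup.subset_closure (Or.inl ⟨i, j, h₁, h₂, _, trivial, rfl⟩), this⟩
  · have := lifts_T₁ hNI i ⟨(0, u), by change 0 - u ∈ N₀; simpa using hu⟩
    rw [T₁_zero] at this
    exact ⟨_, Subgroup.subset_closure (Or.inr ⟨i, _, trivial, rfl⟩), this⟩

/-- `EO(M, q, N₀, I)` is normal if the values of `q₀` generate the unit ideal and `O(M, q)`
preserves `N`. -/
theorem relElem_normal (hNI : Admissible q₀ N₀ I) (hv : valueIdeal q₀ = ⊤)
    (hN : ∀ (g : orth q₀), ∀ v ∈ level N₀ I, g.1 v ∈ level N₀ I) :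
    (relElem q₀ N₀ I).Normal := by
  have hE := elem_normal (valueIdeal_doubleForm hNI hv)
  refine ⟨fun x hx g => ?_⟩
  induction hx using Subgroup.closure_induction with
  | mem x hx =>
    obtain ⟨h, -, t, ht, rfl⟩ := hx
    obtain ⟨φ, hφ, hφt⟩ := exists_mem_elem_double_lifts_one hNI ht
    -- The diagonal pair preserves congruence modulo `N` exactly because `O(M, q)` preserves `N`;
    -- `γ` need not be elementary.
    obtain ⟨γ, hγ⟩ := exists_lifts hNI (g * h) (g * h)
      (fun v w hvw => by rw [← map_sub]; exact hN _ _ hvw)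
      (fun v w hvw => by rw [← map_sub]; exact hN (g * h)⁻¹ _ hvw)
    refine mem_relElem_of_lifts (hE.conj_mem φ hφ γ) ?_
    convert (hγ.mul hφt).mul hγ.inv using 1 <;> group
  | one => rw [mul_one, mul_inv_cancel]; exact one_mem _
  | mul x y _ _ hx hy =>
    have := mul_mem hx hy
    rwa [show g * x * g⁻¹ * (g * y * g⁻¹) = g * (x * y) * g⁻¹ by group] at this
  | inv x _ hx =>
    have := inv_mem hx
    rwa [show (g * x * g⁻¹)⁻¹ = g * x⁻¹ * g⁻¹ by group] at this

theorem commutator_le_relElem (hNI : Admissible q₀ N₀ I) (hv : valueIdeal q₀ = ⊤) :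
    ⁅elem q₀, relOrth q₀ N₀ I⁆ ≤ relElem q₀ N₀ I := by
  have hE := elem_normal (valueIdeal_doubleForm hNI hv)
  rw [Subgroup.commutator_le]
  intro t ht g hg
  have hcongr : ∀ g ∈ relOrth q₀ N₀ I, ∀ v w : Mod K M₀, v - w ∈ level N₀ I →
      v - g.1 w ∈ level N₀ I := fun g hg v w hvw => by
    have := sub_mem hvw (hg w)
    rwa [sub_sub_sub_cancel_right] at this
  obtain ⟨φ, hφ, hφt⟩ := exists_mem_elem_double_lifts hNI ht
  -- The pair `(1, g)` respects congruence since `g` is congruent to the identity, so invariance of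
  -- `N` under all of `O(M, q)` is not needed here.
  obtain ⟨γ, hγ⟩ := exists_lifts hNI 1 g (hcongr g hg) (hcongr g⁻¹ (inv_mem hg))
  refine mem_relElem_of_lifts (mul_mem hφ (hE.conj_mem φ⁻¹ (inv_mem hφ) γ)) ?_
  rw [commutatorElement_def]
  convert hφt.mul ((hγ.mul hφt.inv).mul hγ.inv) using 1 <;> group

end Double

end OddOrth

theorem mainTheorem3 {K : Type*} [CommRing K] {M₀ : Type*} [AddCommGroup M₀] [Module K M₀]
    [Module.Finite K M₀] [Module.Projective K M₀] (ν : ℕ)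
    (hrank : ∀ p : PrimeSpectrum K, Module.rankAtStalk M₀ p = 2 * ν + 1)
    (q₀ : QuadraticForm K M₀) (hq₀ : OddOrth.Semiregular ν q₀)
    (N₀ : Submodule K M₀) (I : Ideal K) (hNI : OddOrth.Admissible q₀ N₀ I) :
    (OddOrth.relElem q₀ N₀ I).Normal ∧
      ⁅OddOrth.elem q₀, OddOrth.relOrth q₀ N₀ I⁆ ≤ OddOrth.relElem q₀ N₀ I :=
  have hv := OddOrth.valueIdeal_eq_top q₀ hq₀
  ⟨OddOrth.relElem_normal hNI hv fun g _ => OddOrth.apply_mem_level hrank hq₀ hNI g,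
    OddOrth.commutator_le_relElem hNI hv⟩
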